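/- Let $\Gamma\subset\mathbb{C}$ be a Jordan curve of class $C^1$ (that is, $\Gamma$ has a closed, simple, continuously differentiable parametrization with nowhere vanishing derivative), let $D$ be the bounded domain enclosed by $\Gamma$, so that $\partial D=\Gamma$, and orient $\Gamma$ positively (i.e. with winding number $1$ about the points of $D$). Suppose that there are $Q\in\mathbb{R}$ and $z_0\in\mathbb{C}$ such that $$\gamma^+(z):=\frac{1}{2\pi i}\int_\Gamma\frac{\overline{\xi}}{\xi-z}\,d\xi=Q(z-z_0)+\overline{z_0}\qquad\text{for all } z\in D.$$ Then $\Gamma$ is an ellipse centered at $z_0$ with axes parallel to the coordinate axes: there are $a,b>0$ such that $$\Gamma=\Big\{z\in\mathbb{C}:\ \frac{(\operatorname{Re}(z-z_0))^2}{a^2}+\frac{(\operatorname{Im}(z-z_0))^2}{b^2}=1\Big\}\qquad\text{and}\qquad Q=\frac{a-b}{a+b}.$$ In particular $|Q|<1$. -/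

import Mathlib

open scoped ComplexConjugate

/-- `c : ℝ → ℂ` is a (regular) parametrization, of period `1`, of a Jordan curve of class `C¹`;
the curve itself, as a subset of the plane, is `Set.range c`. -/
structure IsC1JordanCurve (c : ℝ → ℂ) : Prop where
  contDiff : ContDiff ℝ 1 c
  periodic : Function.Periodic c 1
  injOn : Set.InjOn c (Set.Ico 0 1)
  deriv_ne_zero : ∀ t, deriv c t ≠ 0

/-- The contour integral `∫_Γ f(ξ) dξ` along the closed curve `Γ` parametrized by `c`. -/
noncomputable def contourIntegral (c : ℝ → ℂ) (f : ℂ → ℂ) : ℂ :=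
  ∫ t in (0 : ℝ)..1, f (c t) * deriv c t

/-- The winding number of the closed curve `c` about `z`. -/
noncomputable def windingNumber (c : ℝ → ℂ) (z : ℂ) : ℂ :=
  1 / (2 * Real.pi * Complex.I) * contourIntegral c (fun ξ => 1 / (ξ - z))

/-- `D` is the bounded domain enclosed by the closed curve parametrized by `c`: a bounded
domain whose boundary is the curve. -/
structure Encloses (c : ℝ → ℂ) (D : Set ℂ) : Prop where
  isOpen : IsOpen D
  isConnected : IsConnected D
  isBounded : Bornology.IsBounded D
  frontier_eq : frontier D = Set.range c

/-- The closed curve `c` is positively oriented as the boundary of `D`: it winds once,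
counterclockwise, around every point of `D`. -/
def PositivelyOriented (c : ℝ → ℂ) (D : Set ℂ) : Prop :=
  ∀ z ∈ D, windingNumber c z = 1

/-- The Cauchy integral of the function `ξ ↦ conj ξ` along the curve `c`, at the point `z`. -/
noncomputable def cauchyIntegralConj (c : ℝ → ℂ) (z : ℂ) : ℂ :=
  1 / (2 * Real.pi * Complex.I) * contourIntegral c (fun ξ => conj ξ / (ξ - z))

/-- The ellipse (as a curve) centered at `z₀` with horizontal semi-axis `a` and vertical
semi-axis `b` (used for `a, b > 0`). -/
def ellipse (z₀ : ℂ) (a b : ℝ) : Set ℂ :=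
  {z | (z - z₀).re ^ 2 / a ^ 2 + (z - z₀).im ^ 2 / b ^ 2 = 1}

/-! Let S be the set of points about which the curve winds once. Green's formula gives the Cauchy
integral of `conj` an area form: off the curve it is conj z · n(z) − (1/π)∫_S dw/(z − w), with n the
winding number. The hypothesis therefore prescribes the Cauchy transform of S on D and, by
continuity, on the curve, as π(conj(z − z₀) − Q(z − z₀)). An elliptic disc with semi-axes a, b has
the same transform at its own points, with Q = (a − b)/(a + b) (`setIntegral_ellipticDisc`).

The rest is a comparison argument. If a set of positive area lies on one side of a line through p,
its Cauchy transform at p has a strictly positive component along the normal pointing away from the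
set (`re_mul_setIntegral_one_div_sub_pos`). At the extreme points of the curve in the directions ±1,
±i this forces |Q| < 1. Among the elliptic discs centred at z₀ with semi-axes proportional to 1 + Q
and 1 − Q, let E be the smallest that contains the curve; it touches the curve at some p. Then S ⊆ E
and both have the same transform at p, so the transform of E \ S vanishes at p, although E \ S lies
on one side of the tangent to E there. Hence E \ S is null, and the curve is the boundary of E
(`range_eq_ellipse`).

The Jordan curve theorem is not needed. The winding number jumps by one across the curve, so it
takes only the values 0 and 1, with 0 attained near every point of the curve
(`windingNumber_eq_zero_or_one`). Green's formula comes from Fubini and the transform of a large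
disc. -/

/-! ### Integrality and local constancy of the winding number -/

theorem continuousOn_integral_cauchyKernel {γ g : ℝ → ℂ} (hγ : Continuous γ)
    (hg : Continuous g) {a b : ℝ} (hab : a ≤ b) :
    ContinuousOn (fun z => ∫ t in a..b, 1 / (γ t - z) * g t) (γ '' Set.Icc a b)ᶜ := by
  rw [continuousOn_iff_continuous_domRestrict]
  -- Clamping the parameter with `projIcc` makes the integrand jointly continuous for every real t,
  -- not only on the interval.
  have h : Continuous fun z : ↥(γ '' Set.Icc a b)ᶜ =>
      ∫ t in a..b, 1 / (γ (Set.projIcc a b hab t) - z) * g t := by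
    apply intervalIntegral.continuous_parametric_intervalIntegral_of_continuous'
    refine Continuous.mul (continuous_const.div ?_ fun p h => p.1.2 ?_) ?_
    · exact (hγ.comp (continuous_subtype_val.comp (continuous_projIcc.comp continuous_snd))).sub
        (continuous_subtype_val.comp continuous_fst)
    · exact ⟨_, (Set.projIcc a b hab p.2).2, sub_eq_zero.1 h⟩
    · exact hg.comp continuous_snd
  refine h.congr fun z => intervalIntegral.integral_congr fun t ht => ?_
  rw [Set.uIcc_of_le hab] at ht
  simp only [Set.projIcc_of_mem hab ht]

namespace IsC1JordanCurve

variable {c : ℝ → ℂ}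

theorem continuous (hc : IsC1JordanCurve c) : Continuous c := hc.contDiff.continuous

theorem continuous_deriv (hc : IsC1JordanCurve c) : Continuous (deriv c) :=
  hc.contDiff.continuous_deriv le_rfl

theorem hasDerivAt (hc : IsC1JordanCurve c) (t : ℝ) : HasDerivAt c (deriv c t) t :=
  (hc.contDiff.differentiable one_ne_zero t).hasDerivAt

theorem range_eq_image (hc : IsC1JordanCurve c) (a : ℝ) :
    Set.range c = c '' Set.Icc a (a + 1) :=
  (hc.periodic.image_Icc one_pos a).symm

theorem isCompact_range (hc : IsC1JordanCurve c) : IsCompact (Set.range c) := by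
  rw [hc.range_eq_image 0]
  exact isCompact_Icc.image hc.continuous

theorem isOpen_compl_range (hc : IsC1JordanCurve c) : IsOpen (Set.range c)ᶜ :=
  hc.isCompact_range.isClosed.isOpen_compl

theorem sub_ne_zero {z : ℂ} (hz : z ∉ Set.range c) (t : ℝ) : c t - z ≠ 0 := fun h =>
  hz ⟨t, _root_.sub_eq_zero.1 h⟩

theorem continuous_kernel (hc : IsC1JordanCurve c) {z : ℂ} (hz : z ∉ Set.range c) :
    Continuous fun t => 1 / (c t - z) * deriv c t :=
  (continuous_const.div (hc.continuous.sub continuous_const) (sub_ne_zero hz)).mul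
    hc.continuous_deriv

/-- With F the primitive of the kernel vanishing at 0, the product (c − z)·exp(−F) is constant;
closedness of the curve then gives exp(F 1) = 1. -/
theorem exists_windingNumber_eq_intCast (hc : IsC1JordanCurve c) {z : ℂ}
    (hz : z ∉ Set.range c) : ∃ k : ℤ, windingNumber c z = k := by
  set f : ℝ → ℂ := fun t => 1 / (c t - z) * deriv c t with hf
  have hfc : Continuous f := hc.continuous_kernel hz
  set F : ℝ → ℂ := fun s => ∫ t in (0 : ℝ)..s, f t with hF
  have hFd : ∀ s, HasDerivAt F (f s) s := fun s =>
    intervalIntegral.integral_hasDerivAt_right (hfc.intervalIntegrable _ _)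
      (hfc.stronglyMeasurableAtFilter _ _) hfc.continuousAt
  have hG : ∀ s, HasDerivAt (fun s => (c s - z) * Complex.exp (-F s)) 0 s := by
    intro s
    refine (((hc.hasDerivAt s).sub_const z).mul (hFd s).neg.cexp).congr_deriv ?_
    have := sub_ne_zero hz s
    simp only [hf, Pi.neg_apply]
    field_simp
    ring
  have hconst := is_const_of_deriv_eq_zero (fun s => (hG s).differentiableAt)
    (fun s => (hG s).deriv) 1 0
  have hc1 : c 1 = c 0 := by simpa using hc.periodic 0
  have hF0 : F 0 = 0 := by simp [hF]
  simp only [hc1, hF0, neg_zero, Complex.exp_zero, mul_one] at hconst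
  have hexp : Complex.exp (F 1) = 1 := by
    have h1 : Complex.exp (-F 1) = 1 := by
      have := sub_ne_zero hz 0
      exact mul_left_cancel₀ this (by rw [hconst, mul_one])
    rw [Complex.exp_neg] at h1
    exact inv_eq_one.1 h1
  obtain ⟨k, hk⟩ := Complex.exp_eq_one_iff.1 hexp
  refine ⟨k, ?_⟩
  have hw : windingNumber c z = 1 / (2 * Real.pi * Complex.I) * F 1 := rfl
  rw [hw, hk]
  have := Complex.two_pi_I_ne_zero
  field_simp

theorem continuousOn_windingNumber (hc : IsC1JordanCurve c) :
    ContinuousOn (windingNumber c) (Set.range c)ᶜ := by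
  rw [hc.range_eq_image 0, zero_add]
  exact continuousOn_const.mul
    (continuousOn_integral_cauchyKernel hc.continuous hc.continuous_deriv zero_le_one)

/-- A continuous function with values in the discrete set of integers is constant on a preconnected
set. -/
theorem windingNumber_eq_of_isPreconnected (hc : IsC1JordanCurve c) {s : Set ℂ}
    (hs : IsPreconnected s) (hsc : ∀ z ∈ s, z ∉ Set.range c) {z w : ℂ} (hz : z ∈ s)
    (hw : w ∈ s) : windingNumber c z = windingNumber c w := by
  have hd : DiscreteTopology (Set.range ((↑) : ℤ → ℝ)) :=
    Int.isClosedEmbedding_coe_real.isEmbedding.toHomeomorph.symm.isEmbedding.discreteTopology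
  have h := hs.constant_of_mapsTo (T := Set.range ((↑) : ℤ → ℝ))
    ⟨hd⟩ (f := fun z => (windingNumber c z).re)
    (Complex.continuous_re.comp_continuousOn (hc.continuousOn_windingNumber.mono hsc))
    (fun z hz => by
      obtain ⟨k, hk⟩ := hc.exists_windingNumber_eq_intCast (hsc z hz)
      exact ⟨k, by simp [hk]⟩) hz hw
  obtain ⟨k, hk⟩ := hc.exists_windingNumber_eq_intCast (hsc z hz)
  obtain ⟨l, hl⟩ := hc.exists_windingNumber_eq_intCast (hsc w hw)
  simp only [hk, hl, Complex.intCast_re, Int.cast_inj] at h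
  rw [hk, hl, h]

theorem exists_forall_lt_norm_windingNumber_eq_zero (hc : IsC1JordanCurve c) :
    ∃ R : ℝ, 0 < R ∧ (∀ t, ‖c t‖ < R) ∧
      ∀ z : ℂ, R ≤ ‖z‖ → z ∉ Set.range c ∧ windingNumber c z = 0 := by
  obtain ⟨M, hM⟩ := hc.isCompact_range.isBounded.exists_norm_le
  obtain ⟨K, hK⟩ := (isCompact_Icc.image hc.continuous_deriv :
    IsCompact (deriv c '' Set.Icc 0 1)).isBounded.exists_norm_le
  have hM0 : 0 ≤ M := (norm_nonneg _).trans (hM _ ⟨0, rfl⟩)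
  have hK0 : 0 ≤ K := (norm_nonneg _).trans (hK _ ⟨0, by simp, rfl⟩)
  -- Beyond this radius the distance to the curve is at least K + 1, while |c'| ≤ K, so the integral
  -- has norm at most 1 and the winding number, an integer, is below 1/(2π) · 2 < 1.
  refine ⟨M + K + 1, by positivity, fun t => ?_, fun z hz => ?_⟩
  · have := hM _ ⟨t, rfl⟩
    linarith
  have hd : ∀ t, K + 1 ≤ ‖c t - z‖ := fun t => by
    have h1 := hM _ ⟨t, rfl⟩
    have h2 := norm_sub_norm_le z (c t)
    rw [norm_sub_rev] at h2
    linarith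
  have hz' : z ∉ Set.range c := by
    rintro ⟨t, rfl⟩
    have := hd t
    simp at this
    linarith
  refine ⟨hz', ?_⟩
  obtain ⟨k, hk⟩ := hc.exists_windingNumber_eq_intCast hz'
  have hint : ‖∫ t in (0 : ℝ)..1, 1 / (c t - z) * deriv c t‖ ≤ 1 * |(1 : ℝ) - 0| := by
    refine intervalIntegral.norm_integral_le_of_norm_le_const fun t ht => ?_
    rw [Set.uIoc_of_le zero_le_one] at ht
    have h1 := hK _ ⟨t, ⟨ht.1.le, ht.2⟩, rfl⟩
    have h2 := hd t
    rw [norm_mul, norm_div, norm_one, one_div, inv_mul_le_iff₀ (by linarith)]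
    linarith
  have hlt : ‖windingNumber c z‖ < 1 := by
    have he : windingNumber c z = 1 / (2 * Real.pi * Complex.I) *
      ∫ t in (0 : ℝ)..1, 1 / (c t - z) * deriv c t := rfl
    rw [he, norm_mul]
    have h3 : ‖(1 : ℂ) / (2 * Real.pi * Complex.I)‖ = 1 / (2 * Real.pi) := by
      simp [abs_of_pos Real.pi_pos]
    rw [h3, one_div, inv_mul_lt_iff₀ (by positivity)]
    have := Real.pi_gt_three
    norm_num at hint
    simp only [one_div]
    linarith
  rw [hk, Complex.norm_intCast] at hlt
  have : k = 0 := Int.abs_lt_one_iff.1 (by exact_mod_cast hlt)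
  rw [hk, this, Int.cast_zero]

/-- The ray is connected and reaches the far region, where the winding number vanishes. -/
theorem windingNumber_eq_zero_of_ray (hc : IsC1JordanCurve c) {z d : ℂ} (hd : d ≠ 0)
    (h : ∀ s : ℝ, 0 ≤ s → z + s * d ∉ Set.range c) : windingNumber c z = 0 := by
  obtain ⟨R, -, -, hR⟩ := hc.exists_forall_lt_norm_windingNumber_eq_zero
  have hd' : 0 < ‖d‖ := norm_pos_iff.2 hd
  set s : ℝ := (|R| + ‖z‖) / ‖d‖ with hs
  have hs0 : 0 ≤ s := by positivity
  have hfar : R ≤ ‖z + s * d‖ := by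
    have h1 : ‖(s : ℂ) * d‖ = |R| + ‖z‖ := by
      rw [norm_mul, Complex.norm_real, Real.norm_of_nonneg hs0, hs]
      field_simp
    have h2 := norm_sub_norm_le ((s : ℂ) * d) (-z)
    rw [sub_neg_eq_add, norm_neg, h1, add_comm] at h2
    have := le_abs_self R
    rw [add_comm z]
    rw [add_comm] at h2
    linarith
  rw [← (hR _ hfar).2]
  have hconn : IsPreconnected ((fun s : ℝ => z + s * d) '' Set.Ici 0) :=
    isPreconnected_Ici.image _ (by fun_prop)
  refine hc.windingNumber_eq_of_isPreconnected hconn ?_ ⟨0, by simp, by simp⟩ ⟨s, hs0, rfl⟩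
  rintro _ ⟨s, hs, rfl⟩
  exact h s hs

/-- The curve is the image of the real axis, a null set in the plane, under the differentiable map z
↦ c (re z). -/
theorem volume_range_eq_zero (hc : IsC1JordanCurve c) :
    MeasureTheory.volume (Set.range c) = 0 := by
  have hnull : MeasureTheory.volume {z : ℂ | z.im = 0} = 0 := by
    have h := MeasureTheory.Measure.addHaar_submodule (MeasureTheory.volume : MeasureTheory.Measure ℂ)
      (LinearMap.ker Complex.imLm) (by
        intro h
        have : Complex.I ∈ LinearMap.ker Complex.imLm := h ▸ Submodule.mem_top
        simp at this)
    exact h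
  have hdiff : DifferentiableOn ℝ (fun z : ℂ => c z.re) {z : ℂ | z.im = 0} :=
    ((hc.contDiff.differentiable one_ne_zero).comp
      Complex.reCLM.differentiable).differentiableOn
  have := MeasureTheory.addHaar_image_eq_zero_of_differentiableOn_of_addHaar_eq_zero
    MeasureTheory.volume hdiff hnull
  refine MeasureTheory.measure_mono_null ?_ this
  rintro _ ⟨t, rfl⟩
  exact ⟨t, by simp, by simp⟩

end IsC1JordanCurve

/-! ### Jump of the winding number across the curve -/

/-- The rotation κ chooses a branch of the logarithm whose cut avoids the arc. -/
theorem integral_cauchyKernel_eq_log_sub_log {γ γ' : ℝ → ℂ} (hγ : ∀ t, HasDerivAt γ (γ' t) t)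
    (hγ' : Continuous γ') {a b : ℝ} (hab : a ≤ b) {v κ : ℂ}
    (h : ∀ t ∈ Set.Icc a b, κ * (γ t - v) ∈ Complex.slitPlane) :
    ∫ t in a..b, 1 / (γ t - v) * γ' t =
      Complex.log (κ * (γ b - v)) - Complex.log (κ * (γ a - v)) := by
  have hne : ∀ t ∈ Set.Icc a b, κ * (γ t - v) ≠ 0 := fun t ht =>
    Complex.slitPlane_ne_zero (h t ht)
  have hcont : Continuous γ := continuous_iff_continuousAt.2 fun t => (hγ t).continuousAt
  rw [← Set.uIcc_of_le hab] at h hne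
  refine intervalIntegral.integral_eq_sub_of_hasDerivAt
    (f := fun t => Complex.log (κ * (γ t - v))) (fun t ht => ?_) ?_
  · refine ((((hγ t).sub_const v).const_mul κ).clog_real (h t ht)).congr_deriv ?_
    have h1 := left_ne_zero_of_mul (hne t ht)
    have h2 := right_ne_zero_of_mul (hne t ht)
    field_simp
  · refine ContinuousOn.intervalIntegrable (ContinuousOn.mul ?_ hγ'.continuousOn)
    exact continuousOn_const.div (hcont.sub continuous_const).continuousOn
      fun t ht => right_ne_zero_of_mul (hne t ht)

theorem Complex.log_I_mul_of_re_pos {u : ℂ} (hu : 0 < u.re) :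
    Complex.log (Complex.I * u) = Complex.log u + Real.pi / 2 * Complex.I := by
  have h0 : u ≠ 0 := by rintro rfl; simp at hu
  have h := abs_lt.1 (Complex.abs_arg_lt_pi_div_two_iff.2 (Or.inl hu))
  rw [Complex.log_mul Complex.I_ne_zero h0, Complex.log_I]
  · ring
  · rw [Complex.arg_I]
    constructor <;> linarith [h.1, h.2, Real.pi_pos]

theorem Complex.log_neg_I_mul_of_re_pos {u : ℂ} (hu : 0 < u.re) :
    Complex.log (-Complex.I * u) = Complex.log u - Real.pi / 2 * Complex.I := by
  have h0 : u ≠ 0 := by rintro rfl; simp at hu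
  have h := abs_lt.1 (Complex.abs_arg_lt_pi_div_two_iff.2 (Or.inl hu))
  rw [Complex.log_mul (neg_ne_zero.2 Complex.I_ne_zero) h0, Complex.log_neg_I]
  · ring
  · rw [Complex.arg_neg_I]
    constructor <;> linarith [h.1, h.2, Real.pi_pos]

/-- Jump of the Cauchy integral of the constant `1` along an arc that is a graph over the real
axis: the integral takes the values `G ± π i` on the two sides. -/
theorem integral_cauchyKernel_graph {γ γ' : ℝ → ℂ} (hγ : ∀ t, HasDerivAt γ (γ' t) t)
    (hγ' : Continuous γ') {a b : ℝ} (hab : a ≤ b) {v : ℂ} (ha : (γ a - v).re < 0)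
    (hb : 0 < (γ b - v).re) :
    ((∀ t ∈ Set.Icc a b, (γ t - v).re = 0 → (γ t - v).im < 0) →
      ∫ t in a..b, 1 / (γ t - v) * γ' t =
        Complex.log (γ b - v) - Complex.log (-(γ a - v)) + Real.pi * Complex.I) ∧
    ((∀ t ∈ Set.Icc a b, (γ t - v).re = 0 → 0 < (γ t - v).im) →
      ∫ t in a..b, 1 / (γ t - v) * γ' t =
        Complex.log (γ b - v) - Complex.log (-(γ a - v)) - Real.pi * Complex.I) := by
  have ha' : 0 < (-(γ a - v)).re := by simpa using ha
  have e1 : Complex.I * (γ a - v) = -Complex.I * -(γ a - v) := by ring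
  have e2 : -Complex.I * (γ a - v) = Complex.I * -(γ a - v) := by ring
  constructor <;> intro h
  -- Multiplication by i sends the negative imaginary axis to the positive reals, so an arc crossing
  -- the vertical only below v stays in the slit plane.
  · rw [integral_cauchyKernel_eq_log_sub_log hγ hγ' hab (κ := Complex.I), e1,
      Complex.log_I_mul_of_re_pos hb, Complex.log_neg_I_mul_of_re_pos ha']
    · ring
    · intro t ht
      rw [Complex.mem_slitPlane_iff]
      by_cases h0 : (γ t - v).re = 0
      · left
        have := h t ht h0
        rw [Complex.I_mul_re]
        linarith
      · right
        rwa [Complex.I_mul_im]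
  · rw [integral_cauchyKernel_eq_log_sub_log hγ hγ' hab (κ := -Complex.I), e2,
      Complex.log_I_mul_of_re_pos ha', Complex.log_neg_I_mul_of_re_pos hb]
    · ring
    · intro t ht
      rw [Complex.mem_slitPlane_iff, neg_mul, Complex.neg_re, Complex.neg_im]
      by_cases h0 : (γ t - v).re = 0
      · left
        have := h t ht h0
        rw [Complex.I_mul_re]
        linarith
      · right
        rw [Complex.I_mul_im]
        exact neg_ne_zero.2 h0

namespace IsC1JordanCurve

variable {c : ℝ → ℂ}

theorem apply_ne_of_mem_Ioo (hc : IsC1JordanCurve c) {s t : ℝ} (ht : t ∈ Set.Ioo s (s + 1)) :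
    c t ≠ c s := by
  intro h
  have hfr : ∀ x, c (Int.fract x) = c x := fun x => by
    have := hc.periodic.sub_zsmul_eq (x := x) ⌊x⌋
    rw [Int.fract]
    simpa using this
  have hmem : ∀ x : ℝ, Int.fract x ∈ Set.Ico (0 : ℝ) 1 := fun x =>
    ⟨Int.fract_nonneg x, Int.fract_lt_one x⟩
  have h1 := hc.injOn (hmem t) (hmem s) (by rw [hfr, hfr, h])
  obtain ⟨m, hm⟩ := Int.fract_eq_fract.1 h1
  have h2 : (0 : ℝ) < m := by rw [← hm]; linarith [ht.1]
  have h3 : (m : ℝ) < 1 := by rw [← hm]; linarith [ht.2]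
  have h2' : 0 < m := by exact_mod_cast h2
  have h3' : m < 1 := by exact_mod_cast h3
  omega

/-- Near a point of a `C¹` Jordan curve the winding number takes exactly two values, which are
consecutive integers. -/
theorem exists_windingNumber_jump (hc : IsC1JordanCurve c) (t₀ : ℝ) :
    ∃ k : ℤ, ∃ r > 0,
      (∀ w ∉ Set.range c, dist w (c t₀) < r →
        windingNumber c w = k ∨ windingNumber c w = k + 1) ∧
      ∀ ε > 0, (∃ w ∉ Set.range c, dist w (c t₀) < ε ∧ windingNumber c w = k) ∧
        ∃ w ∉ Set.range c, dist w (c t₀) < ε ∧ windingNumber c w = k + 1 := by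
  set d := deriv c t₀ with hd
  have hd0 : d ≠ 0 := hc.deriv_ne_zero t₀
  have hdn : 0 < ‖d‖ := norm_pos_iff.2 hd0
  -- Normalization: γ passes through 0 with derivative 1, so it is locally a graph over the real
  -- axis.
  set γ : ℝ → ℂ := fun t => (c t - c t₀) / d with hγdef
  set γ' : ℝ → ℂ := fun t => deriv c t / d with hγ'def
  have hγ : ∀ t, HasDerivAt γ (γ' t) t := fun t => ((hc.hasDerivAt t).sub_const _).div_const d
  have hγ' : Continuous γ' := hc.continuous_deriv.div_const d
  have hγc : Continuous γ := (hc.continuous.sub continuous_const).div_const d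
  have hγ0 : γ t₀ = 0 := by simp [hγdef]
  have hγre : ∀ t, HasDerivAt (fun t => (γ t).re) (γ' t).re t := fun t =>
    Complex.reCLM.hasFDerivAt.comp_hasDerivAt t (hγ t)
  obtain ⟨δ₀, hδ₀, hδ₀'⟩ : ∃ δ₀ > 0, ∀ t, dist t t₀ < δ₀ → 0 < (γ' t).re := by
    have h1 : ContinuousAt (fun t => (γ' t).re) t₀ :=
      (Complex.continuous_re.comp hγ').continuousAt
    have h2 : (0 : ℝ) < (γ' t₀).re := by
      simp [hγ'def, ← hd, div_self hd0]
    exact Metric.eventually_nhds_iff.1 (h1.eventually (lt_mem_nhds h2))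
  obtain ⟨δ, hδ, hδ1, hδ2⟩ : ∃ δ > 0, δ < δ₀ ∧ δ < 1 / 2 :=
    ⟨min (δ₀ / 2) (1 / 4), by positivity, (min_le_left _ _).trans_lt (by linarith),
      (min_le_right _ _).trans_lt (by norm_num)⟩
  have hmono : StrictMonoOn (fun t => (γ t).re) (Set.Icc (t₀ - δ) (t₀ + δ)) := by
    refine strictMonoOn_of_deriv_pos (convex_Icc _ _)
      (Complex.continuous_re.comp hγc).continuousOn fun t ht => ?_
    rw [interior_Icc] at ht
    rw [(hγre t).deriv]
    refine hδ₀' t ?_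
    rw [Real.dist_eq, abs_lt]
    constructor <;> linarith [ht.1, ht.2]
  have ht₀ : t₀ ∈ Set.Icc (t₀ - δ) (t₀ + δ) := ⟨by linarith, by linarith⟩
  have hneg : (γ (t₀ - δ)).re < 0 := by
    have := hmono ⟨le_rfl, by linarith⟩ ht₀ (by linarith : t₀ - δ < t₀)
    simpa [hγ0] using this
  have hposi : 0 < (γ (t₀ + δ)).re := by
    have := hmono ht₀ ⟨by linarith, le_rfl⟩ (by linarith : t₀ < t₀ + δ)
    simpa [hγ0] using this
  set K := γ '' Set.Icc (t₀ + δ) (t₀ + 1 - δ) with hK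
  have hKc : IsClosed K := (isCompact_Icc.image hγc).isClosed
  have h0K : (0 : ℂ) ∉ K := by
    rintro ⟨t, ht, h⟩
    refine hc.apply_ne_of_mem_Ioo (s := t₀) (t := t) ⟨by linarith [ht.1], by linarith [ht.2]⟩ ?_
    simpa [hγdef, hd0, sub_eq_zero] using h
  set rest : ℂ → ℂ := fun v => ∫ t in (t₀ + δ)..(t₀ + 1 - δ), 1 / (γ t - v) * γ' t with hrest
  -- The part of the integral that is continuous across the curve; only the term ±πi depends on the
  -- side.
  set G : ℂ → ℂ := fun v =>
    rest v + (Complex.log (γ (t₀ + δ) - v) - Complex.log (-(γ (t₀ - δ) - v))) with hG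
  have hGc : ContinuousAt G 0 := by
    refine ContinuousAt.add ?_ (ContinuousAt.sub ?_ ?_)
    · exact (continuousOn_integral_cauchyKernel hγc hγ' (by linarith)).continuousAt
        (hKc.isOpen_compl.mem_nhds h0K)
    · refine ContinuousAt.clog (by fun_prop) ?_
      rw [Complex.mem_slitPlane_iff]
      left
      simpa using hposi
    · refine ContinuousAt.clog (by fun_prop) ?_
      rw [Complex.mem_slitPlane_iff]
      left
      simpa using hneg
  -- With G within π/2 of G 0, two of its values differ by less than π, while distinct integers
  -- times 2πi differ by at least 2π.
  obtain ⟨ρ, hρ, hρ'⟩ : ∃ ρ > 0, ∀ v : ℂ, dist v 0 < ρ →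
      (((γ (t₀ - δ) - v).re < 0 ∧ 0 < (γ (t₀ + δ) - v).re) ∧ v ∉ K) ∧
        dist (G v) (G 0) < Real.pi / 2 := by
    have e1 : ContinuousAt (fun v => (γ (t₀ - δ) - v).re) 0 := by fun_prop
    have e2 : ContinuousAt (fun v => (γ (t₀ + δ) - v).re) 0 := by fun_prop
    exact Metric.eventually_nhds_iff.1
      ((((e1.eventually (gt_mem_nhds (by simpa using hneg))).and
        (e2.eventually (lt_mem_nhds (by simpa using hposi)))).and
        (hKc.isOpen_compl.mem_nhds h0K)).and
        (hGc (Metric.ball_mem_nhds _ (by positivity))))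
  have hint : ∀ w ∉ Set.range c, 2 * Real.pi * Complex.I * windingNumber c w =
      (∫ t in (t₀ - δ)..(t₀ + δ), 1 / (γ t - (w - c t₀) / d) * γ' t) +
        rest ((w - c t₀) / d) := by
    intro w hw
    set v := (w - c t₀) / d with hv
    have hker : (fun t => 1 / (γ t - v) * γ' t) = fun t => 1 / (c t - w) * deriv c t := by
      funext t
      have h1 := sub_ne_zero hw t
      have h2 : γ t - v = (c t - w) / d := by
        simp only [hγdef, hv]
        ring
      rw [h2]
      simp only [hγ'def]
      field_simp
    have hcont := hc.continuous_kernel hw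
    have hper : Function.Periodic (fun t => 1 / (c t - w) * deriv c t) 1 := fun t => by
      have h1 : deriv c (t + 1) = deriv c t := by
        rw [← deriv_comp_add_const]
        congr 1
        exact funext hc.periodic
      simp only [hc.periodic t, h1]
    have h2 := hper.intervalIntegral_add_eq 0 (t₀ - δ)
    rw [zero_add] at h2
    have h3 : windingNumber c w = 1 / (2 * Real.pi * Complex.I) *
      ∫ t in (0 : ℝ)..1, 1 / (c t - w) * deriv c t := rfl
    rw [hrest]
    simp only [hker]
    rw [intervalIntegral.integral_add_adjacent_intervals (hcont.intervalIntegrable _ _)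
      (hcont.intervalIntegrable _ _), h3, h2]
    have := Complex.two_pi_I_ne_zero
    rw [show t₀ - δ + 1 = t₀ + 1 - δ by ring]
    field_simp
  have hup : ∀ w ∉ Set.range c, dist ((w - c t₀) / d) 0 < ρ →
      (∀ t ∈ Set.Icc (t₀ - δ) (t₀ + δ), (γ t - (w - c t₀) / d).re = 0 →
        (γ t - (w - c t₀) / d).im < 0) →
      2 * Real.pi * Complex.I * windingNumber c w =
        G ((w - c t₀) / d) + Real.pi * Complex.I := by
    intro w hw hv h
    obtain ⟨⟨⟨h1, h2⟩, -⟩, -⟩ := hρ' _ hv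
    rw [hint w hw, (integral_cauchyKernel_graph hγ hγ' (by linarith) h1 h2).1 h, hG]
    ring
  have hdown : ∀ w ∉ Set.range c, dist ((w - c t₀) / d) 0 < ρ →
      (∀ t ∈ Set.Icc (t₀ - δ) (t₀ + δ), (γ t - (w - c t₀) / d).re = 0 →
        0 < (γ t - (w - c t₀) / d).im) →
      2 * Real.pi * Complex.I * windingNumber c w =
        G ((w - c t₀) / d) - Real.pi * Complex.I := by
    intro w hw hv h
    obtain ⟨⟨⟨h1, h2⟩, -⟩, -⟩ := hρ' _ hv
    rw [hint w hw, (integral_cauchyKernel_graph hγ hγ' (by linarith) h1 h2).2 h, hG]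
    ring
  -- The arc meets the vertical through v at most once, by monotonicity of re γ, and not at v
  -- itself; so v is strictly above or strictly below it.
  have hside : ∀ w ∉ Set.range c,
      (∀ t ∈ Set.Icc (t₀ - δ) (t₀ + δ), (γ t - (w - c t₀) / d).re = 0 →
        (γ t - (w - c t₀) / d).im < 0) ∨
      (∀ t ∈ Set.Icc (t₀ - δ) (t₀ + δ), (γ t - (w - c t₀) / d).re = 0 →
        0 < (γ t - (w - c t₀) / d).im) := by
    intro w hw
    by_contra! hcon
    obtain ⟨⟨t, ht, h1, h2⟩, s, hs, h3, h4⟩ := hcon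
    have hts : t = s := by
      refine hmono.injOn ht hs ?_
      rw [Complex.sub_re] at h1 h3
      exact (sub_eq_zero.1 h1).trans (sub_eq_zero.1 h3).symm
    subst hts
    have : γ t - (w - c t₀) / d = 0 := Complex.ext h1 (le_antisymm h4 h2)
    refine sub_ne_zero hw t ?_
    have h5 : γ t - (w - c t₀) / d = (c t - w) / d := by
      simp only [hγdef]
      ring
    rw [h5] at this
    simpa [hd0] using this
  have hvert : ∀ y : ℝ, y ≠ 0 → |y| < ρ → c t₀ + d * (y * Complex.I) ∉ Set.range c := by
    intro y hy hyρ hmem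
    rw [hc.range_eq_image (t₀ - δ)] at hmem
    obtain ⟨t, ht, h⟩ := hmem
    have hγt : γ t = y * Complex.I := by
      simp only [hγdef, h]
      field_simp
      ring
    rcases le_or_gt t (t₀ + δ) with h1 | h1
    · have : t = t₀ := by
        refine hmono.injOn ⟨ht.1, h1⟩ ht₀ ?_
        simp [hγt, hγ0]
      rw [this, hγ0] at hγt
      simp [hy] at hγt
    · refine (hρ' (y * Complex.I) (by simpa using hyρ)).1.2 ⟨t, ⟨h1.le, ?_⟩, hγt⟩
      linarith [ht.2]
  have hvertdiv : ∀ y : ℝ, (c t₀ + d * (y * Complex.I) - c t₀) / d = y * Complex.I := by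
    intro y
    field_simp
    ring
  have hvertdist : ∀ y : ℝ, dist (c t₀ + d * (y * Complex.I)) (c t₀) = ‖d‖ * |y| := by
    intro y
    rw [dist_eq_norm, add_sub_cancel_left]
    simp
  have hzero : ∀ y : ℝ, ∀ t ∈ Set.Icc (t₀ - δ) (t₀ + δ), (γ t - y * Complex.I).re = 0 →
      (γ t - y * Complex.I).im = -y := by
    intro y t ht h
    have : t = t₀ := by
      refine hmono.injOn ht ht₀ ?_
      simpa [hγ0] using h
    simp [this, hγ0]
  have hup' : ∀ y : ℝ, 0 < y → y < ρ →
      2 * Real.pi * Complex.I * windingNumber c (c t₀ + d * (y * Complex.I)) =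
        G (y * Complex.I) + Real.pi * Complex.I := by
    intro y hy hyρ
    have := hup _ (hvert y hy.ne' (by rwa [abs_of_pos hy]))
    rw [hvertdiv] at this
    refine this (by simpa [abs_of_pos hy] using hyρ) fun t ht h => ?_
    rw [hzero y t ht h]
    linarith
  have hdown' : ∀ y : ℝ, y < 0 → -y < ρ →
      2 * Real.pi * Complex.I * windingNumber c (c t₀ + d * (y * Complex.I)) =
        G (y * Complex.I) - Real.pi * Complex.I := by
    intro y hy hyρ
    have := hdown _ (hvert y hy.ne (by rwa [abs_of_neg hy]))
    rw [hvertdiv] at this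
    refine this (by simpa [abs_of_neg hy] using hyρ) fun t ht h => ?_
    rw [hzero y t ht h]
    linarith
  set y₀ := ρ / 2 with hy₀
  have hy₀ρ : |y₀| < ρ := by
    rw [abs_of_pos (by positivity)]
    linarith
  obtain ⟨m, hm⟩ := hc.exists_windingNumber_eq_intCast
    (hvert y₀ (by positivity) hy₀ρ)
  have hm' := hup' y₀ (by positivity) (by linarith)
  rw [hm] at hm'
  have hsame : ∀ w ∉ Set.range c, ∀ v : ℂ, dist v 0 < ρ → ∀ l : ℤ,
      2 * Real.pi * Complex.I * (windingNumber c w - m - l) = G v - G (y₀ * Complex.I) →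
      windingNumber c w = m + l := by
    intro w hw v hv l h
    obtain ⟨j, hj⟩ := hc.exists_windingNumber_eq_intCast hw
    have h1 := (hρ' _ hv).2
    have h2 := (hρ' (y₀ * Complex.I) (by simpa using hy₀ρ)).2
    have h3 : ‖G v - G (y₀ * Complex.I)‖ < Real.pi := by
      rw [← dist_eq_norm]
      have := dist_triangle_right (G v) (G (y₀ * Complex.I)) (G 0)
      linarith
    rw [← h, hj] at h3
    have h4 : (2 * Real.pi * Complex.I * ((j : ℂ) - m - l)) =
        2 * Real.pi * Complex.I * ((j - m - l : ℤ) : ℂ) := by push_cast; ring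
    rw [h4, norm_mul, Complex.norm_intCast] at h3
    have h5 : ‖(2 * Real.pi * Complex.I : ℂ)‖ = 2 * Real.pi := by
      simp [abs_of_pos Real.pi_pos]
    rw [h5] at h3
    have h6 : |((j - m - l : ℤ) : ℝ)| < 1 := by
      by_contra! hge
      nlinarith [Real.pi_pos]
    have h7 : j - m - l = 0 := Int.abs_lt_one_iff.1 (by exact_mod_cast h6)
    rw [hj]
    have : j = m + l := by omega
    rw [this]
    push_cast
    ring
  have hupm : ∀ w ∉ Set.range c, ∀ v : ℂ, dist v 0 < ρ →
      2 * Real.pi * Complex.I * windingNumber c w = G v + Real.pi * Complex.I →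
      windingNumber c w = m := by
    intro w hw v hv h
    have := hsame w hw v hv 0 (by
      push_cast
      linear_combination h - hm')
    simpa using this
  have hdownm : ∀ w ∉ Set.range c, ∀ v : ℂ, dist v 0 < ρ →
      2 * Real.pi * Complex.I * windingNumber c w = G v - Real.pi * Complex.I →
      windingNumber c w = m - 1 := by
    intro w hw v hv h
    have := hsame w hw v hv (-1) (by
      push_cast
      linear_combination h - hm')
    rw [this]
    push_cast
    ring
  -- Here m is the value on the left of the curve, so the lower of the two values is m − 1.
  refine ⟨m - 1, ρ * ‖d‖, by positivity, fun w hw hwd => ?_, fun ε hε => ?_⟩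
  · have hv : dist ((w - c t₀) / d) 0 < ρ := by
      rw [dist_zero_right, norm_div, div_lt_iff₀ hdn, ← dist_eq_norm]
      exact hwd
    push_cast
    rcases hside w hw with h | h
    · right
      rw [hupm w hw _ hv (hup w hw hv h)]
      ring
    · left
      exact hdownm w hw _ hv (hdown w hw hv h)
  · obtain ⟨y, hy, hyρ, hyε⟩ : ∃ y : ℝ, 0 < y ∧ y < ρ ∧ ‖d‖ * y < ε := by
      refine ⟨min (ρ / 2) (ε / (2 * ‖d‖)), by positivity,
        (min_le_left _ _).trans_lt (by linarith), ?_⟩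
      calc ‖d‖ * min (ρ / 2) (ε / (2 * ‖d‖)) ≤ ‖d‖ * (ε / (2 * ‖d‖)) := by gcongr; exact min_le_right _ _
        _ = ε / 2 := by field_simp
        _ < ε := by linarith
    push_cast
    refine ⟨⟨c t₀ + d * ((-y : ℝ) * Complex.I), hvert (-y) (by linarith) (by
        rwa [abs_neg, abs_of_pos hy]), ?_, ?_⟩,
      ⟨c t₀ + d * (y * Complex.I), hvert y hy.ne' (by rwa [abs_of_pos hy]), ?_, ?_⟩⟩
    · rw [hvertdist, abs_neg, abs_of_pos hy]
      exact hyε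
    · refine hdownm _ (hvert (-y) (by linarith) (by rwa [abs_neg, abs_of_pos hy]))
        ((-y : ℝ) * Complex.I) ?_ (hdown' (-y) (by linarith) (by linarith))
      simpa [abs_of_pos hy] using hyρ
    · rw [hvertdist, abs_of_pos hy]
      exact hyε
    · rw [hupm _ (hvert y hy.ne' (by rwa [abs_of_pos hy])) (y * Complex.I)
        (by simpa [abs_of_pos hy] using hyρ) (hup' y hy hyρ)]
      ring

/-- If a `C¹` Jordan curve winds once around some point, its winding number only takes the values
`0` and `1`, and the value `0` is taken arbitrarily close to every point of the curve. -/
theorem windingNumber_eq_zero_or_one (hc : IsC1JordanCurve c) {z₁ : ℂ} (hz₁ : z₁ ∉ Set.range c)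
    (h₁ : windingNumber c z₁ = 1) :
    (∀ w ∉ Set.range c, windingNumber c w = 0 ∨ windingNumber c w = 1) ∧
      ∀ t, ∀ ε > 0, ∃ w ∉ Set.range c, dist w (c t) < ε ∧ windingNumber c w = 0 := by
  choose k r hr hval hnear using hc.exists_windingNumber_jump
  -- Near t both values of the pair k s, k s + 1 belong to the pair k t, k t + 1, so the pairs
  -- coincide.
  have hloc : IsLocallyConstant k := by
    rw [IsLocallyConstant.iff_eventually_eq]
    intro t
    have hev : ∀ᶠ s in nhds t, dist (c s) (c t) < r t :=
      hc.continuous.continuousAt (Metric.ball_mem_nhds _ (hr t))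
    filter_upwards [hev] with s hs
    obtain ⟨⟨w, hw, hwd, hwk⟩, w', hw', hwd', hwk'⟩ := hnear s (r t - dist (c s) (c t))
      (by linarith)
    have h1 := hval t w hw (by linarith [dist_triangle w (c s) (c t)])
    have h2 := hval t w' hw' (by linarith [dist_triangle w' (c s) (c t)])
    rw [hwk] at h1
    rw [hwk'] at h2
    norm_cast at h1 h2
    omega
  have hk : ∀ t, k t = k 0 := fun t => hloc.apply_eq_of_preconnectedSpace t 0
  have hall : ∀ w ∉ Set.range c, windingNumber c w = k 0 ∨ windingNumber c w = k 0 + 1 := by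
    intro w hw
    -- The open ball about w reaching to the nearest curve point misses the curve, which carries the
    -- value at w up to that point.
    obtain ⟨p, ⟨t, rfl⟩, ht⟩ := hc.isCompact_range.exists_infDist_eq_dist
      (Set.range_nonempty c) w
    have hpos : 0 < dist w (c t) := dist_pos.2 fun h => hw ⟨t, h.symm⟩
    have hball : ∀ z ∈ Metric.ball w (dist w (c t)), z ∉ Set.range c := by
      intro z hz hzc
      have := Metric.infDist_le_dist_of_mem (x := w) hzc
      rw [Metric.mem_ball'] at hz
      linarith
    have hcl : c t ∈ closure (Metric.ball w (dist w (c t))) := by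
      rw [closure_ball w hpos.ne', Metric.mem_closedBall']
    obtain ⟨z, hz, hzd⟩ := Metric.mem_closure_iff.1 hcl (r t) (hr t)
    rw [hc.windingNumber_eq_of_isPreconnected (convex_ball _ _).isPreconnected hball
      (Metric.mem_ball_self hpos) hz, ← hk t]
    exact hval t z (hball z hz) (by rwa [dist_comm])
  obtain ⟨R, -, -, hR⟩ := hc.exists_forall_lt_norm_windingNumber_eq_zero
  -- The value 0 far away and the value 1 at z₁ leave only k = 0.
  have hfar := hR (|R| : ℝ) (by simpa using le_abs_self R)
  have h0 := hall _ hfar.1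
  have h1 := hall z₁ hz₁
  rw [hfar.2] at h0
  rw [h₁] at h1
  norm_cast at h0 h1
  have hk0 : k 0 = 0 := by omega
  refine ⟨fun w hw => by simpa [hk0] using hall w hw, fun t ε hε => ?_⟩
  simpa [hk t, hk0] using (hnear t ε hε).1

end IsC1JordanCurve

/-! ### Integrability of the Cauchy kernel -/

open MeasureTheory in
theorem integrableOn_one_div_ball (R : ℝ) :
    IntegrableOn (fun u : ℂ => 1 / u) (Metric.ball 0 R) := by
  have h1 : IntegrableOn (fun u : ℂ => ‖u‖⁻¹) (Metric.ball 0 R) := by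
    rw [integrableOn_fun_norm_addHaar (volume : Measure ℂ) (f := fun y : ℝ => y⁻¹),
      Complex.finrank_real_complex]
    refine (integrableOn_const (C := (1 : ℝ)) (by simp)).congr_fun (fun y hy => ?_)
      measurableSet_Ioo
    have : y ≠ 0 := hy.1.ne'
    simp [this]
  refine (integrable_norm_iff ?_).1 ?_
  · exact (measurable_const.div measurable_id).aestronglyMeasurable
  · simpa [IntegrableOn] using h1

open MeasureTheory in
theorem integrableOn_one_div_sub {s : Set ℂ} (hs : Bornology.IsBounded s) (z : ℂ) :
    IntegrableOn (fun w => 1 / (z - w)) s := by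
  obtain ⟨R, hR⟩ := hs.subset_ball z
  refine IntegrableOn.mono_set ?_ hR
  have h := ((integrable_indicator_iff measurableSet_ball).2
    (integrableOn_one_div_ball R)).comp_sub_left z
  rw [← integrable_indicator_iff measurableSet_ball]
  refine h.congr (Filter.Eventually.of_forall fun w => ?_)
  by_cases hw : w ∈ Metric.ball z R
  · have : z - w ∈ Metric.ball (0 : ℂ) R := by
      rwa [mem_ball_zero_iff, ← dist_eq_norm, ← Metric.mem_ball']
    simp only [Set.indicator_of_mem, hw, this]
  · have : z - w ∉ Metric.ball (0 : ℂ) R := by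
      rwa [mem_ball_zero_iff, ← dist_eq_norm, ← Metric.mem_ball']
    simp only [Set.indicator_of_notMem, hw, this, not_false_eq_true]

/-! ### Cauchy transform of an elliptic disc -/

/-- The real-linear map scaling the real part by `a` and the imaginary part by `b`. -/
noncomputable def axisScaling (a b : ℝ) : ℂ →L[ℝ] ℂ :=
  ((a + b) / 2 : ℝ) • ContinuousLinearMap.id ℝ ℂ + ((a - b) / 2 : ℝ) • Complex.conjCLE.toContinuousLinearMap

theorem axisScaling_apply (a b : ℝ) (z : ℂ) :
    axisScaling a b z = ((a + b) / 2 : ℝ) * z + ((a - b) / 2 : ℝ) * conj z := by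
  simp [axisScaling]

theorem axisScaling_re (a b : ℝ) (z : ℂ) : (axisScaling a b z).re = a * z.re := by
  simp [axisScaling_apply]
  ring

theorem axisScaling_im (a b : ℝ) (z : ℂ) : (axisScaling a b z).im = b * z.im := by
  simp [axisScaling_apply]
  ring

theorem axisScaling_ne_zero {a b : ℝ} (ha : 0 < a) (hb : 0 < b) {z : ℂ} (hz : z ≠ 0) :
    axisScaling a b z ≠ 0 := by
  intro h
  have h1 := congrArg Complex.re h
  have h2 := congrArg Complex.im h
  rw [axisScaling_re] at h1
  rw [axisScaling_im] at h2
  refine hz (Complex.ext ?_ ?_)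
  · simpa [ha.ne'] using h1
  · simpa [hb.ne'] using h2

theorem axisScaling_det (a b : ℝ) : (axisScaling a b).det = a * b := by
  rw [ContinuousLinearMap.det, ← LinearMap.det_toMatrix Complex.basisOneI, Matrix.det_fin_two]
  simp [LinearMap.toMatrix_apply, axisScaling_re, axisScaling_im]

-- On the unit circle conj e = e⁻¹, so the integrand is h(e⁻¹) with h holomorphic on the closed
-- disc, and the mean value property gives h 0 = conj η / (a + b).
open Real in
theorem integral_re_mul_div_axisScaling {a b : ℝ} (ha : 0 < a) (hb : 0 < b) (η : ℂ) :
    ∫ θ in (0 : ℝ)..2 * π, ((η * conj (circleMap 0 1 θ)).re : ℂ) /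
      axisScaling a b (circleMap 0 1 θ) = 2 * π / (a + b) * conj η := by
  set h : ℂ → ℂ := fun u => (η * u ^ 2 + conj η) / ((a + b) + (a - b) * u ^ 2) with hh
  have hab : (a + b : ℂ) ≠ 0 := by exact_mod_cast (by positivity : a + b ≠ 0)
  have hden : ∀ u : ℂ, ‖u‖ ≤ 1 → (a + b : ℂ) + (a - b) * u ^ 2 ≠ 0 := by
    intro u hu h0
    have h1 : ‖(a + b : ℂ)‖ = a + b := by
      rw [← Complex.ofReal_add, Complex.norm_real, Real.norm_of_nonneg (by positivity)]
    have h2 : ‖(a - b : ℂ) * u ^ 2‖ ≤ |a - b| := by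
      rw [norm_mul, norm_pow, ← Complex.ofReal_sub, Complex.norm_real, Real.norm_eq_abs]
      exact mul_le_of_le_one_right (abs_nonneg _) (pow_le_one₀ (norm_nonneg _) hu)
    rw [← norm_neg, ← eq_neg_iff_add_eq_zero.2 h0, h1, le_abs] at h2
    rcases h2 with h2 | h2 <;> linarith
  have hmean : circleAverage h 0 1 = h 0 := by
    refine DiffContOnCl.circleAverage (DifferentiableOn.diffContOnCl fun u hu => ?_)
    rw [abs_one, closure_ball _ one_ne_zero, mem_closedBall_zero_iff] at hu
    refine DifferentiableAt.differentiableWithinAt (DifferentiableAt.div ?_ ?_ (hden u hu)) <;>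
      fun_prop
  have hinv : circleAverage (fun u => h u⁻¹) 0 1 = circleAverage h 0 1 :=
    circleAverage_zero_one_congr_inv
  rw [hmean, circleAverage_def, hh] at hinv
  have hcongr : ∀ θ : ℝ, ((η * conj (circleMap 0 1 θ)).re : ℂ) /
      axisScaling a b (circleMap 0 1 θ) = h (circleMap 0 1 θ)⁻¹ := by
    intro θ
    set e := circleMap 0 1 θ with he
    have hen : ‖e‖ = 1 := by simp [he]
    have he0 : e ≠ 0 := by
      intro h0
      simp [h0] at hen
    have hconj : conj e = e⁻¹ := by
      rw [Complex.inv_def, Complex.normSq_eq_norm_sq, hen]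
      simp
    have hd := hden e⁻¹ (by simp [hen])
    have hL := axisScaling_ne_zero ha hb he0
    rw [axisScaling_apply, hconj] at hL ⊢
    rw [Complex.re_eq_add_conj, map_mul, map_inv₀, hconj, inv_inv]
    simp only [hh]
    rw [div_eq_div_iff hL hd]
    push_cast
    field_simp
  simp_rw [hcongr]
  simp only [hh]
  rw [Complex.real_smul] at hinv
  have hpi : ((2 * π : ℝ) : ℂ) ≠ 0 := by exact_mod_cast Real.two_pi_pos.ne'
  rw [Complex.ofReal_inv, inv_mul_eq_iff_eq_mul₀ hpi] at hinv
  rw [hinv]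
  push_cast
  simp
  field_simp

-- Pairing θ with θ + π removes the square root, which is even in the direction while the
-- denominator is odd.
open Real in
theorem integral_chord_div_axisScaling {a b : ℝ} (ha : 0 < a) (hb : 0 < b) (η : ℂ) :
    ∫ θ in (-π)..π, (((η * conj (circleMap 0 1 θ)).re +
        √((η * conj (circleMap 0 1 θ)).re ^ 2 + (1 - ‖η‖ ^ 2)) : ℝ) : ℂ) /
      axisScaling a b (circleMap 0 1 θ) = 2 * π / (a + b) * conj η := by
  set g : ℝ → ℂ := fun θ => (((η * conj (circleMap 0 1 θ)).re +
        √((η * conj (circleMap 0 1 θ)).re ^ 2 + (1 - ‖η‖ ^ 2)) : ℝ) : ℂ) /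
      axisScaling a b (circleMap 0 1 θ) with hg
  have hgc : Continuous g := by
    refine Continuous.div ?_ ?_ fun θ => axisScaling_ne_zero ha hb ?_
    · fun_prop
    · fun_prop
    · simp
  have hper : Function.Periodic g (2 * π) := fun θ => by
    simp only [hg, periodic_circleMap 0 1 θ]
  have hadd : ∀ θ, g θ + g (θ + π) = 2 * (((η * conj (circleMap 0 1 θ)).re : ℂ) /
      axisScaling a b (circleMap 0 1 θ)) := by
    intro θ
    have he : circleMap 0 1 (θ + π) = -circleMap 0 1 θ := by
      simp [circleMap, add_mul, Complex.exp_add]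
    have h0 : axisScaling a b (circleMap 0 1 θ) ≠ 0 := axisScaling_ne_zero ha hb (by simp)
    simp only [hg, he, map_neg, mul_neg, Complex.neg_re, neg_sq]
    push_cast
    field_simp
    ring
  have h1 : ∫ θ in (-π)..π, g θ = ∫ θ in (0 : ℝ)..2 * π, g θ := by
    have := hper.intervalIntegral_add_eq (-π) 0
    rwa [zero_add, show -π + 2 * π = π by ring] at this
  have h2 : ∫ θ in (0 : ℝ)..2 * π, g (θ + π) = ∫ θ in (0 : ℝ)..2 * π, g θ := by
    rw [intervalIntegral.integral_comp_add_right]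
    have := hper.intervalIntegral_add_eq (0 + π) 0
    rwa [zero_add (2 * π), show 0 + π + 2 * π = 2 * π + π by ring] at this
  have h3 : (∫ θ in (0 : ℝ)..2 * π, g θ) + ∫ θ in (0 : ℝ)..2 * π, g θ =
      2 * (2 * π / (a + b) * conj η) := by
    rw [← integral_re_mul_div_axisScaling ha hb, ← intervalIntegral.integral_const_mul]
    nth_rewrite 2 [← h2]
    have hgc' : Continuous fun θ => g (θ + π) := hgc.comp (continuous_add_const π)
    rw [← intervalIntegral.integral_add (hgc.intervalIntegrable _ _)
      (hgc'.intervalIntegrable _ _)]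
    simp_rw [hadd]
  rw [h1]
  linear_combination h3 / 2

theorem norm_sub_mul_circleMap_le_one_iff {η : ℂ} (hη : ‖η‖ ≤ 1) {r θ : ℝ} (hr : 0 < r) :
    ‖η - r * circleMap 0 1 θ‖ ≤ 1 ↔ r ≤ (η * conj (circleMap 0 1 θ)).re +
        √((η * conj (circleMap 0 1 θ)).re ^ 2 + (1 - ‖η‖ ^ 2)) := by
  set B := (η * conj (circleMap 0 1 θ)).re with hB
  have h1 : ‖η - r * circleMap 0 1 θ‖ ^ 2 = ‖η‖ ^ 2 - 2 * r * B + r ^ 2 := by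
    rw [← Complex.normSq_eq_norm_sq, Complex.normSq_sub, Complex.normSq_mul,
      Complex.normSq_eq_norm_sq, Complex.normSq_eq_norm_sq (circleMap 0 1 θ),
      Complex.normSq_ofReal, map_mul, Complex.conj_ofReal, mul_left_comm, Complex.re_ofReal_mul,
      ← hB]
    simp
    ring
  have h2 : 0 ≤ 1 - ‖η‖ ^ 2 := by
    nlinarith [norm_nonneg η]
  rw [← sq_le_one_iff₀ (norm_nonneg _), h1, ← sub_le_iff_le_add']
  constructor
  · intro h
    refine Real.le_sqrt_of_sq_le ?_
    nlinarith
  · intro h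
    have h3 : |r - B| ≤ √(B ^ 2 + (1 - ‖η‖ ^ 2)) := by
      refine abs_le.2 ⟨?_, h⟩
      have : B ≤ √(B ^ 2 + (1 - ‖η‖ ^ 2)) :=
        (le_abs_self B).trans (Real.abs_le_sqrt (by linarith))
      linarith
    have h5 : (r - B) ^ 2 ≤ B ^ 2 + (1 - ‖η‖ ^ 2) := by
      rw [← sq_abs, ← Real.sq_sqrt (by positivity : 0 ≤ B ^ 2 + (1 - ‖η‖ ^ 2))]
      exact pow_le_pow_left₀ (abs_nonneg _) h3 2
    nlinarith

-- In polar coordinates about η the Jacobian r cancels the 1/r of the kernel, leaving the chord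
-- length in direction θ divided by `axisScaling` of that direction.
open MeasureTheory Real in
theorem setIntegral_closedBall_one_div_axisScaling {a b : ℝ} (ha : 0 < a) (hb : 0 < b) {η : ℂ}
    (hη : ‖η‖ ≤ 1) :
    ∫ ζ in Metric.closedBall (0 : ℂ) 1, 1 / (axisScaling a b η - axisScaling a b ζ) =
      2 * π / (a + b) * conj η := by
  set f : ℂ → ℂ := fun u => {u : ℂ | ‖η - u‖ ≤ 1}.indicator (fun u => 1 / axisScaling a b u) u
    with hf
  have h1 : ∫ ζ in Metric.closedBall (0 : ℂ) 1, 1 / (axisScaling a b η - axisScaling a b ζ) =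
      ∫ u, f u := by
    rw [← integral_indicator measurableSet_closedBall, ← integral_sub_left_eq_self _ volume η]
    refine integral_congr_ae (.of_forall fun u => ?_)
    by_cases hu : ‖η - u‖ ≤ 1
    · simp [hf, Set.indicator, hu, ← map_sub]
    · simp [hf, Set.indicator, hu]
  set A : Set (ℝ × ℝ) := {p | ‖η - p.1 * circleMap 0 1 p.2‖ ≤ 1} with hA
  have hAc : IsClosed A := isClosed_le (by fun_prop) continuous_const
  set F : ℝ × ℝ → ℂ := A.indicator fun p => 1 / axisScaling a b (circleMap 0 1 p.2) with hF
  have hpolar : ∀ p ∈ polarCoord.target, p.1 • f (Complex.polarCoord.symm p) = F p := by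
    intro p hp
    have hp1 : 0 < p.1 := hp.1
    have h2 : Complex.polarCoord.symm p = p.1 * circleMap 0 1 p.2 := by
      rw [Complex.polarCoord_symm_apply]
      simp [circleMap, Complex.exp_mul_I]
    rw [h2]
    by_cases hpA : p ∈ A
    · have hpA' : (p.1 * circleMap 0 1 p.2 : ℂ) ∈ {u : ℂ | ‖η - u‖ ≤ 1} := hpA
      have h3 : axisScaling a b (p.1 * circleMap 0 1 p.2) =
          p.1 * axisScaling a b (circleMap 0 1 p.2) := by
        rw [← Complex.real_smul, map_smul, Complex.real_smul]
      rw [hf, hF, Set.indicator_of_mem hpA]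
      simp only [Set.indicator_of_mem hpA']
      rw [h3, Complex.real_smul]
      have h4 : axisScaling a b (circleMap 0 1 p.2) ≠ 0 := axisScaling_ne_zero ha hb (by simp)
      have h5 : (p.1 : ℂ) ≠ 0 := by exact_mod_cast hp1.ne'
      field_simp
    · have hpA' : (p.1 * circleMap 0 1 p.2 : ℂ) ∉ {u : ℂ | ‖η - u‖ ≤ 1} := hpA
      rw [hf, hF, Set.indicator_of_notMem hpA]
      simp only [Set.indicator_of_notMem hpA', smul_zero]
  have hcontk : Continuous fun p : ℝ × ℝ => 1 / axisScaling a b (circleMap 0 1 p.2) := by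
    refine Continuous.div continuous_const (by fun_prop) fun p => axisScaling_ne_zero ha hb ?_
    simp
  have hFint : Integrable F ((volume.restrict (Set.Ioi 0)).prod
      (volume.restrict (Set.Ioo (-π) π))) := by
    rw [Measure.prod_restrict, ← IntegrableOn, ← Measure.volume_eq_prod]
    rw [hF, IntegrableOn, integrable_indicator_iff hAc.measurableSet, IntegrableOn,
      Measure.restrict_restrict hAc.measurableSet]
    -- The bound 2 on the radius comes from r ≤ 1 + ‖η‖.
    have hK : IsCompact (Set.Icc (0 : ℝ) 2 ×ˢ Set.Icc (-π) π) :=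
      isCompact_Icc.prod isCompact_Icc
    refine IntegrableOn.mono_set (hcontk.continuousOn.integrableOn_compact hK) ?_
    rintro ⟨r, θ⟩ ⟨hp, hr, hθ⟩
    have hr' : 0 < r := hr
    refine ⟨⟨hr'.le, ?_⟩, ⟨hθ.1.le, hθ.2.le⟩⟩
    have hp' : ‖η - r * circleMap 0 1 θ‖ ≤ 1 := hp
    have h2 := norm_sub_norm_le ((r : ℂ) * circleMap 0 1 θ) η
    rw [norm_sub_rev, norm_mul, Complex.norm_real, Real.norm_of_nonneg hr'.le] at h2
    simp at h2
    simp
    linarith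
  rw [h1, ← Complex.integral_comp_polarCoord_symm, setIntegral_congr_fun
    polarCoord.open_target.measurableSet hpolar]
  rw [polarCoord_target, Measure.volume_eq_prod, ← Measure.prod_restrict,
    integral_prod_symm _ hFint, ← integral_chord_div_axisScaling ha hb,
    intervalIntegral.integral_of_le (by linarith [pi_pos]), integral_Ioc_eq_integral_Ioo]
  refine integral_congr_ae (.of_forall fun θ => ?_)
  set B := (η * conj (circleMap 0 1 θ)).re with hB
  set ρ := B + √(B ^ 2 + (1 - ‖η‖ ^ 2)) with hρ
  have hρ0 : 0 ≤ ρ := by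
    have h2 : 0 ≤ 1 - ‖η‖ ^ 2 := by nlinarith [norm_nonneg η]
    have := (neg_abs_le B)
    have := Real.abs_le_sqrt (by linarith : B ^ 2 ≤ B ^ 2 + (1 - ‖η‖ ^ 2))
    linarith
  have hsec : ∀ r ∈ Set.Ioi (0 : ℝ), F (r, θ) = (Set.Ioc 0 ρ).indicator
      (fun _ => 1 / axisScaling a b (circleMap 0 1 θ)) r := by
    intro r hr
    have := norm_sub_mul_circleMap_le_one_iff hη (θ := θ) (r := r) hr
    by_cases h : r ≤ ρ
    · have hm : (r, θ) ∈ A := this.2 h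
      have hm' : r ∈ Set.Ioc 0 ρ := ⟨hr, h⟩
      rw [hF, Set.indicator_of_mem hm, Set.indicator_of_mem hm']
    · have hm : (r, θ) ∉ A := fun hm => h (this.1 hm)
      have hm' : r ∉ Set.Ioc 0 ρ := fun hm => h hm.2
      rw [hF, Set.indicator_of_notMem hm, Set.indicator_of_notMem hm']
  simp only
  rw [setIntegral_congr_fun measurableSet_Ioi hsec, setIntegral_indicator measurableSet_Ioc,
    Set.inter_eq_right.2 Set.Ioc_subset_Ioi_self, setIntegral_const]
  rw [Real.volume_real_Ioc_of_le hρ0, sub_zero, Complex.real_smul, mul_one_div]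

/-- The closed elliptic region with centre `z₀` and semi-axes `a`, `b`. -/
def ellipticDisc (z₀ : ℂ) (a b : ℝ) : Set ℂ :=
  {z | (z - z₀).re ^ 2 / a ^ 2 + (z - z₀).im ^ 2 / b ^ 2 ≤ 1}

theorem mem_ellipticDisc_add_axisScaling_iff {a b : ℝ} (ha : 0 < a) (hb : 0 < b) {z₀ η : ℂ} :
    z₀ + axisScaling a b η ∈ ellipticDisc z₀ a b ↔ ‖η‖ ≤ 1 := by
  rw [ellipticDisc, Set.mem_ofPred_eq, add_sub_cancel_left, axisScaling_re, axisScaling_im,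
    ← sq_le_one_iff₀ (norm_nonneg _), ← Complex.normSq_eq_norm_sq, Complex.normSq_apply]
  have : (a * η.re) ^ 2 / a ^ 2 + (b * η.im) ^ 2 / b ^ 2 = η.re * η.re + η.im * η.im := by
    field_simp
  rw [this]

theorem exists_add_axisScaling_eq {a b : ℝ} (ha : 0 < a) (hb : 0 < b) (z₀ z : ℂ) :
    ∃ η, z₀ + axisScaling a b η = z := by
  refine ⟨⟨(z - z₀).re / a, (z - z₀).im / b⟩, Complex.ext ?_ ?_⟩
  · rw [Complex.add_re, axisScaling_re]
    field_simp
    simp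
  · rw [Complex.add_im, axisScaling_im]
    field_simp
    simp

theorem ellipticDisc_eq_image {a b : ℝ} (ha : 0 < a) (hb : 0 < b) (z₀ : ℂ) :
    ellipticDisc z₀ a b = (fun η => z₀ + axisScaling a b η) '' Metric.closedBall 0 1 := by
  ext z
  obtain ⟨η, rfl⟩ := exists_add_axisScaling_eq ha hb z₀ z
  rw [mem_ellipticDisc_add_axisScaling_iff ha hb]
  constructor
  · intro h
    exact ⟨η, by simpa using h, rfl⟩
  · rintro ⟨ζ, hζ, h⟩
    have : z₀ + axisScaling a b ζ ∈ ellipticDisc z₀ a b :=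
      (mem_ellipticDisc_add_axisScaling_iff ha hb).2 (by simpa using hζ)
    rw [← mem_ellipticDisc_add_axisScaling_iff ha hb (z₀ := z₀)]
    exact h ▸ this

/-- The Cauchy transform of an elliptic region, at the points of the region. -/
theorem setIntegral_ellipticDisc {a b : ℝ} (ha : 0 < a) (hb : 0 < b) {z₀ z : ℂ}
    (hz : z ∈ ellipticDisc z₀ a b) :
    ∫ w in ellipticDisc z₀ a b, 1 / (z - w) =
      Real.pi * (conj (z - z₀) - (a - b) / (a + b) * (z - z₀)) := by
  obtain ⟨η, rfl⟩ := exists_add_axisScaling_eq ha hb z₀ z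
  rw [mem_ellipticDisc_add_axisScaling_iff ha hb] at hz
  have hinj : Function.Injective fun η => z₀ + axisScaling a b η := by
    intro x y hxy
    by_contra hne
    refine axisScaling_ne_zero ha hb (sub_ne_zero.2 hne) ?_
    rw [map_sub, sub_eq_zero]
    exact add_left_cancel hxy
  rw [ellipticDisc_eq_image ha hb, MeasureTheory.integral_image_eq_integral_abs_det_fderiv_smul
    MeasureTheory.volume Metric.isClosed_closedBall.measurableSet
    (fun x _ => ((axisScaling a b).hasFDerivAt.const_add z₀).hasFDerivWithinAt) hinj.injOn]
  simp only [add_sub_add_left_eq_sub, add_sub_cancel_left]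
  rw [MeasureTheory.integral_smul, setIntegral_closedBall_one_div_axisScaling ha hb hz,
    axisScaling_det, abs_of_pos (by positivity), Complex.real_smul, axisScaling_apply]
  have hab : (a + b : ℂ) ≠ 0 := by exact_mod_cast (by positivity : a + b ≠ 0)
  simp only [map_add, map_mul, Complex.conj_conj, Complex.conj_ofReal]
  push_cast
  field_simp
  ring

/-! ### Continuity of Cauchy transforms -/

open MeasureTheory in
theorem setIntegral_ball_one_div_sub {E : Type*} [NormedAddCommGroup E] [NormedSpace ℝ E]
    (f : ℂ → E) (ξ : ℂ) (R : ℝ) :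
    ∫ w in Metric.ball ξ R, f (ξ - w) = ∫ u in Metric.ball 0 R, f u := by
  rw [← integral_indicator measurableSet_ball, ← integral_indicator measurableSet_ball,
    ← integral_sub_left_eq_self _ volume ξ]
  refine integral_congr_ae (.of_forall fun u => ?_)
  by_cases hu : ‖u‖ < R
  · simp [Set.indicator, hu, dist_eq_norm]
  · simp [Set.indicator, hu, dist_eq_norm]

open MeasureTheory in
theorem setIntegral_norm_one_div_sub_le {s : Set ℂ} {ξ : ℂ} {R : ℝ}
    (hs : s ⊆ Metric.ball ξ R) :
    ∫ w in s, ‖1 / (ξ - w)‖ ≤ ∫ u in Metric.ball (0 : ℂ) R, ‖1 / u‖ := by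
  rw [← setIntegral_ball_one_div_sub (fun u => ‖1 / u‖) ξ R]
  exact setIntegral_mono_set (integrableOn_one_div_sub Metric.isBounded_ball ξ).norm
    (.of_forall fun w => norm_nonneg _) hs.eventuallyLE

open MeasureTheory in
/-- The Cauchy transform of a bounded set with negligible boundary is continuous. -/
theorem continuous_setIntegral_one_div_sub {s : Set ℂ} (hs : Bornology.IsBounded s)
    (hsm : MeasurableSet s) (hfr : volume (frontier s) = 0) :
    Continuous fun z => ∫ w in s, 1 / (z - w) := by
  -- Substituting u = z − w fixes the singularity at 0, so dominated convergence applies; only the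
  -- indicator moves, and it converges off the null boundary.
  have h1 : (fun z => ∫ w in s, 1 / (z - w)) =
      fun z => ∫ u, s.indicator (fun _ => (1 : ℂ)) (z - u) * (1 / u) := by
    funext z
    rw [← integral_indicator hsm, ← integral_sub_left_eq_self _ volume z]
    refine integral_congr_ae (.of_forall fun u => ?_)
    by_cases hu : z - u ∈ s
    · simp [hu]
    · simp [hu]
  rw [h1, continuous_iff_continuousAt]
  intro z₀
  obtain ⟨R, hR⟩ := hs.subset_ball z₀
  have hind : Measurable (s.indicator fun _ => (1 : ℂ)) := measurable_const.indicator hsm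
  refine tendsto_integral_filter_of_dominated_convergence
    (fun u => ‖(Metric.ball (0 : ℂ) (R + 1)).indicator (fun u => 1 / u) u‖) ?_ ?_ ?_ ?_
  · refine .of_forall fun z => Measurable.aestronglyMeasurable ?_
    exact (hind.comp (measurable_const.sub measurable_id)).mul
      (measurable_const.div measurable_id)
  · filter_upwards [Metric.ball_mem_nhds z₀ one_pos] with z hz
    refine .of_forall fun u => ?_
    by_cases hu : z - u ∈ s
    · have h2 : u ∈ Metric.ball (0 : ℂ) (R + 1) := by
        have h3 := hR hu
        rw [Metric.mem_ball, dist_eq_norm] at hz h3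
        rw [mem_ball_zero_iff]
        calc ‖u‖ = ‖(z - z₀) - (z - u - z₀)‖ := by congr 1; ring
          _ ≤ ‖z - z₀‖ + ‖z - u - z₀‖ := norm_sub_le _ _
          _ < R + 1 := by linarith
      rw [Set.indicator_of_mem h2, Set.indicator_of_mem hu, one_mul]
    · rw [Set.indicator_of_notMem hu, zero_mul, norm_zero]
      exact norm_nonneg _
  · exact ((integrable_indicator_iff measurableSet_ball).2
      (integrableOn_one_div_ball (R + 1))).norm
  · have h2 : ∀ᵐ u : ℂ, z₀ - u ∉ frontier s := by
      have h3 : ∀ᵐ w : ℂ, w ∉ frontier s := measure_eq_zero_iff_ae_notMem.1 hfr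
      exact (Measure.measurePreserving_sub_left volume z₀).quasiMeasurePreserving.ae h3
    filter_upwards [h2] with u hu
    have hlim : Filter.Tendsto (fun z => z - u) (nhds z₀) (nhds (z₀ - u)) :=
      (continuous_id.sub continuous_const).continuousAt
    refine tendsto_const_nhds.congr' ?_
    by_cases hm : z₀ - u ∈ s
    · have hint : z₀ - u ∈ interior s := by
        by_contra h
        exact hu ⟨subset_closure hm, h⟩
      filter_upwards [hlim (isOpen_interior.mem_nhds hint)] with z hz
      rw [Set.indicator_of_mem hm, Set.indicator_of_mem (interior_subset hz)]
    · have hcl : z₀ - u ∉ closure s := fun h => hu ⟨h, fun h' => hm (interior_subset h')⟩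
      filter_upwards [hlim (isClosed_closure.isOpen_compl.mem_nhds hcl)] with z hz
      rw [Set.indicator_of_notMem hm, Set.indicator_of_notMem fun h => hz (subset_closure h)]

/-! ### The winding region and Green's formula -/

/-- The set of points around which the curve `c` winds once. -/
def windingRegion (c : ℝ → ℂ) : Set ℂ :=
  {z | z ∉ Set.range c ∧ windingNumber c z = 1}

namespace IsC1JordanCurve

variable {c : ℝ → ℂ}

theorem exists_ball_windingNumber_eq (hc : IsC1JordanCurve c) {z : ℂ} (hz : z ∉ Set.range c) :
    ∃ ε > 0, ∀ w ∈ Metric.ball z ε, w ∉ Set.range c ∧ windingNumber c w = windingNumber c z := by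
  obtain ⟨ε, hε, h⟩ := Metric.isOpen_iff.1 hc.isOpen_compl_range z hz
  exact ⟨ε, hε, fun w hw => ⟨h hw, hc.windingNumber_eq_of_isPreconnected
    (convex_ball z ε).isPreconnected (fun x hx => h hx) hw (Metric.mem_ball_self hε)⟩⟩

theorem isOpen_windingRegion (hc : IsC1JordanCurve c) : IsOpen (windingRegion c) := by
  refine Metric.isOpen_iff.2 fun z hz => ?_
  obtain ⟨ε, hε, h⟩ := hc.exists_ball_windingNumber_eq hz.1
  exact ⟨ε, hε, fun w hw => ⟨(h w hw).1, (h w hw).2.trans hz.2⟩⟩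

theorem frontier_windingRegion_subset (hc : IsC1JordanCurve c) :
    frontier (windingRegion c) ⊆ Set.range c := by
  intro z hz
  by_contra hzc
  obtain ⟨ε, hε, h⟩ := hc.exists_ball_windingNumber_eq hzc
  obtain ⟨w, hw, hwd⟩ := Metric.mem_closure_iff.1 hz.1 ε hε
  rw [dist_comm] at hwd
  have hz1 : z ∈ windingRegion c := ⟨hzc, by rw [← (h w hwd).2, hw.2]⟩
  exact hz.2 (hc.isOpen_windingRegion.interior_eq.symm ▸ hz1)

theorem isBounded_windingRegion (hc : IsC1JordanCurve c) :
    Bornology.IsBounded (windingRegion c) := by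
  obtain ⟨R, -, -, hR⟩ := hc.exists_forall_lt_norm_windingNumber_eq_zero
  refine (Metric.isBounded_ball (x := (0 : ℂ)) (r := R)).subset fun z hz => ?_
  rw [mem_ball_zero_iff]
  by_contra! h
  have := hz.2
  rw [(hR z h).2] at this
  exact zero_ne_one this

theorem continuous_cauchyTransform_windingRegion (hc : IsC1JordanCurve c) :
    Continuous fun z => ∫ w in windingRegion c, 1 / (z - w) :=
  continuous_setIntegral_one_div_sub hc.isBounded_windingRegion
    hc.isOpen_windingRegion.measurableSet
    (MeasureTheory.measure_mono_null hc.frontier_windingRegion_subset hc.volume_range_eq_zero)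

-- Justifies Fubini in Green's formula: the inner integral of the norm is bounded uniformly along
-- the curve.
open MeasureTheory in
theorem integrable_one_div_sub_prod (hc : IsC1JordanCurve c) {s : Set ℂ}
    (hs : Bornology.IsBounded s) :
    Integrable (fun p : ℝ × ℂ => 1 / (c p.1 - p.2))
      ((volume.restrict (Set.Ioc 0 1)).prod (volume.restrict s)) := by
  have hsub' : Continuous fun p : ℝ × ℂ => c p.1 - p.2 :=
    (hc.continuous.comp continuous_fst).sub continuous_snd
  have hm : Measurable fun p : ℝ × ℂ => 1 / (c p.1 - p.2) :=
    measurable_const.div hsub'.measurable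
  obtain ⟨R, hR⟩ := (hc.isCompact_range.isBounded.union hs).subset_ball 0
  have hsub : ∀ t, s ⊆ Metric.ball (c t) (R + R) := by
    intro t w hw
    have h1 := hR (Or.inr hw)
    have h2 := hR (Or.inl ⟨t, rfl⟩)
    rw [Metric.mem_ball] at h1 h2 ⊢
    linarith [dist_triangle_right w (c t) 0]
  rw [integrable_prod_iff hm.aestronglyMeasurable]
  refine ⟨.of_forall fun t => integrableOn_one_div_sub hs (c t), ?_⟩
  have hmi : AEStronglyMeasurable (fun t => ∫ w in s, ‖1 / (c t - w)‖)
      (volume.restrict (Set.Ioc (0 : ℝ) 1)) :=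
    (hm.norm.stronglyMeasurable.integral_prod_right' (ν := volume.restrict s)).aestronglyMeasurable
  set C : ℝ := ∫ u in Metric.ball (0 : ℂ) (R + R), ‖1 / u‖ with hC
  have hle : ∀ t, ‖∫ w in s, ‖1 / (c t - w)‖‖ ≤ C := by
    intro t
    rw [Real.norm_of_nonneg (integral_nonneg fun w => norm_nonneg _)]
    exact setIntegral_norm_one_div_sub_le (hsub t)
  exact Integrable.of_bound hmi C (.of_forall hle)

open MeasureTheory in
/-- Green's formula for the kernel `(conj ξ - conj z) / (ξ - z)`. -/
theorem integral_conj_sub_div (hc : IsC1JordanCurve c)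
    (h01 : ∀ w ∉ Set.range c, windingNumber c w = 0 ∨ windingNumber c w = 1)
    {z : ℂ} (hz : z ∉ Set.range c) :
    ∫ t in (0 : ℝ)..1, (conj (c t) - conj z) / (c t - z) * deriv c t =
      -2 * Complex.I * ∫ w in windingRegion c, 1 / (z - w) := by
  obtain ⟨R, hR0, hRc, hR⟩ := hc.exists_forall_lt_norm_windingNumber_eq_zero
  set r := R + ‖z‖ with hr
  have hr0 : 0 < r := by positivity
  -- A disc containing z, the curve and the winding region. Its Cauchy transform is π · conj, so
  -- conj ξ − conj z becomes an area integral over B.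
  set B := ellipticDisc 0 r r with hB
  have hmemB : ∀ w, w ∈ B ↔ ‖w‖ ≤ r := by
    intro w
    rw [hB, ellipticDisc, Set.mem_ofPred_eq, sub_zero, ← add_div, div_le_one (by positivity),
      ← sq_le_sq₀ (norm_nonneg w) hr0.le, ← Complex.normSq_eq_norm_sq, Complex.normSq_apply]
    ring_nf
  have hBb : Bornology.IsBounded B := by
    refine (Metric.isBounded_closedBall (x := (0 : ℂ)) (r := r)).subset fun w hw => ?_
    rw [mem_closedBall_zero_iff]
    exact (hmemB w).1 hw
  have hBint : ∀ ξ ∈ B, ∫ w in B, 1 / (ξ - w) = Real.pi * conj ξ := by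
    intro ξ hξ
    rw [setIntegral_ellipticDisc hr0 hr0 hξ]
    simp
  have hzB : z ∈ B := (hmemB z).2 (by linarith)
  have hcB : ∀ t, c t ∈ B := fun t => (hmemB _).2 (by linarith [hRc t, norm_nonneg z])
  have hSB : windingRegion c ⊆ B := by
    intro w hw
    rw [hmemB]
    by_contra! h
    have := hw.2
    rw [(hR w (by linarith [norm_nonneg z])).2] at this
    exact zero_ne_one this
  have hne : ∀ t, c t - z ≠ 0 := sub_ne_zero hz
  set H : ℝ → ℂ → ℂ := fun t w =>
    1 / (c t - z) * deriv c t * (1 / (c t - w)) - 1 / (c t - z) * deriv c t * (1 / (z - w)) with hH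
  have hker := hc.continuous_kernel hz
  have hHint : Integrable (Function.uncurry H)
      ((volume.restrict (Set.Ioc 0 1)).prod (volume.restrict B)) := by
    obtain ⟨M, hM⟩ := (isCompact_Icc.image hker :
      IsCompact ((fun t => 1 / (c t - z) * deriv c t) '' Set.Icc 0 1)).isBounded.exists_norm_le
    refine Integrable.sub ?_ ?_
    · refine (hc.integrable_one_div_sub_prod hBb).bdd_mul (c := M)
        (hker.comp continuous_fst).aestronglyMeasurable ?_
      rw [Measure.prod_restrict]
      refine ae_restrict_of_ae_restrict_of_subset (t := Set.Ioc 0 1 ×ˢ Set.univ)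
        (Set.prod_mono_right (Set.subset_univ _)) ?_
      refine (ae_restrict_mem (measurableSet_Ioc.prod MeasurableSet.univ)).mono fun p hp => ?_
      exact hM _ ⟨p.1, Set.Ioc_subset_Icc_self hp.1, rfl⟩
    · exact Integrable.mul_prod (f := fun t => 1 / (c t - z) * deriv c t)
        (g := fun w => 1 / (z - w))
        ((hker.integrableOn_Icc (a := 0) (b := 1)).mono_set Set.Ioc_subset_Icc_self)
        (integrableOn_one_div_sub hBb z)
  have hinner : ∀ t, ∫ w in B, H t w =
      Real.pi * ((conj (c t) - conj z) / (c t - z) * deriv c t) := by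
    intro t
    rw [hH]
    simp only
    rw [integral_sub ((integrableOn_one_div_sub hBb _).const_mul _)
      ((integrableOn_one_div_sub hBb _).const_mul _), integral_const_mul, integral_const_mul,
      hBint _ (hcB t), hBint z hzB]
    ring
  have hinner' : ∀ᵐ w ∂(volume.restrict B), ∫ t in Set.Ioc (0 : ℝ) 1, H t w =
      -(2 * Real.pi * Complex.I) * (windingRegion c).indicator (fun w => 1 / (z - w)) w := by
    have h1 : ∀ᵐ w : ℂ, w ∉ Set.range c := measure_eq_zero_iff_ae_notMem.1 hc.volume_range_eq_zero
    have h2 : ∀ᵐ w : ℂ, w ≠ z := Measure.ae_ne volume z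
    filter_upwards [ae_restrict_of_ae h1, ae_restrict_of_ae h2] with w hw hwz
    have hwz' : z - w ≠ 0 := _root_.sub_ne_zero.2 hwz.symm
    -- Partial fractions cancel the factor c t − z, so integrating in t yields the winding number
    -- about w.
    have h3 : ∀ t, H t w = -(1 / (z - w)) * (1 / (c t - w) * deriv c t) := by
      intro t
      have h4 := hne t
      have h5 := sub_ne_zero hw t
      rw [hH]
      field_simp
      ring
    have h6 : ∫ t in (0 : ℝ)..1, 1 / (c t - w) * deriv c t =
        2 * Real.pi * Complex.I * windingNumber c w := by
      have h7 : windingNumber c w = 1 / (2 * Real.pi * Complex.I) *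
        ∫ t in (0 : ℝ)..1, 1 / (c t - w) * deriv c t := rfl
      rw [h7]
      have := Complex.two_pi_I_ne_zero
      field_simp
    simp_rw [h3]
    rw [integral_const_mul, ← intervalIntegral.integral_of_le zero_le_one, h6]
    rcases h01 w hw with h | h
    · have : w ∉ windingRegion c := fun hm => by
        have := hm.2
        rw [h] at this
        exact zero_ne_one this
      rw [h, Set.indicator_of_notMem this]
      ring
    · rw [h, Set.indicator_of_mem (show w ∈ windingRegion c from ⟨hw, h⟩)]
      ring
  have hswap := integral_integral_swap hHint
  simp_rw [hinner] at hswap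
  rw [integral_congr_ae hinner', integral_const_mul, integral_const_mul,
    ← intervalIntegral.integral_of_le zero_le_one,
    setIntegral_indicator hc.isOpen_windingRegion.measurableSet,
    Set.inter_eq_right.2 hSB] at hswap
  have hpi : (Real.pi : ℂ) ≠ 0 := by exact_mod_cast Real.pi_ne_zero
  refine mul_left_cancel₀ hpi (hswap.trans ?_)
  ring

/-- Split conj ξ as (conj ξ − conj z) + conj z: Green's formula handles the first term, the winding
number the second. -/
theorem cauchyIntegralConj_eq (hc : IsC1JordanCurve c)
    (h01 : ∀ w ∉ Set.range c, windingNumber c w = 0 ∨ windingNumber c w = 1)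
    {z : ℂ} (hz : z ∉ Set.range c) :
    cauchyIntegralConj c z = conj z * windingNumber c z -
      1 / Real.pi * ∫ w in windingRegion c, 1 / (z - w) := by
  have hG := hc.integral_conj_sub_div h01 hz
  have hker := hc.continuous_kernel hz
  have h1 : ∀ t, conj (c t) / (c t - z) * deriv c t =
      (conj (c t) - conj z) / (c t - z) * deriv c t +
        conj z * (1 / (c t - z) * deriv c t) := by
    intro t
    ring
  have h2 : Continuous fun t => (conj (c t) - conj z) / (c t - z) * deriv c t := by
    refine Continuous.mul (Continuous.div ?_ ?_ (sub_ne_zero hz)) hc.continuous_deriv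
    · exact (Complex.continuous_conj.comp hc.continuous).sub continuous_const
    · exact hc.continuous.sub continuous_const
  have h3 : Continuous fun t => conj z * (1 / (c t - z) * deriv c t) :=
    continuous_const.mul hker
  rw [cauchyIntegralConj, windingNumber, contourIntegral, contourIntegral]
  simp_rw [h1]
  rw [intervalIntegral.integral_add (h2.intervalIntegrable _ _)
    (h3.intervalIntegrable _ _), intervalIntegral.integral_const_mul, hG]
  have := Complex.I_ne_zero
  have hpi : (Real.pi : ℂ) ≠ 0 := by exact_mod_cast Real.pi_ne_zero
  field_simp
  ring

end IsC1JordanCurve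

/-! ### Supporting lines, and comparison with an ellipse -/

theorem re_div_eq_re_conj_mul_div_normSq (ν u : ℂ) :
    (ν * (1 / u)).re = (conj ν * u).re / Complex.normSq u := by
  rw [mul_one_div, Complex.div_re]
  simp
  ring

open MeasureTheory in
/-- The Cauchy transform of a set lying on one side of a line through `p` is directed away from
the set at `p`. -/
theorem re_mul_setIntegral_one_div_sub_pos {s : Set ℂ} (hs : Bornology.IsBounded s)
    (hsm : MeasurableSet s) (h0 : volume s ≠ 0) {p ν : ℂ}
    (h : ∀ w ∈ s, w ≠ p → 0 < (conj ν * (p - w)).re) :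
    0 < (ν * ∫ w in s, 1 / (p - w)).re := by
  have hint : IntegrableOn (fun w => ν * (1 / (p - w))) s :=
    (integrableOn_one_div_sub hs p).const_mul ν
  have hpos : ∀ w ∈ s, w ≠ p → 0 < (ν * (1 / (p - w))).re := by
    intro w hw hwp
    rw [re_div_eq_re_conj_mul_div_normSq]
    exact div_pos (h w hw hwp) (Complex.normSq_pos.2 (sub_ne_zero.2 hwp.symm))
  rw [← integral_const_mul, ← Complex.reCLM_apply, ← ContinuousLinearMap.integral_comp_comm _ hint]
  simp only [Complex.reCLM_apply]
  have hre : IntegrableOn (fun w => (ν * (1 / (p - w))).re) s := hint.re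
  rw [setIntegral_pos_iff_support_of_nonneg_ae ?_ hre]
  · have h1 : s \ {p} ⊆ Function.support (fun w => (ν * (1 / (p - w))).re) ∩ s :=
      fun w hw => ⟨(hpos w hw.1 hw.2).ne', hw.1⟩
    refine lt_of_lt_of_le ?_ (measure_mono h1)
    rw [measure_sdiff_null (measure_singleton p)]
    exact pos_iff_ne_zero.2 h0
  · filter_upwards [ae_restrict_mem hsm] with w hw
    by_cases hwp : w = p
    · simp [hwp]
    · exact (hpos w hw hwp).le

namespace IsC1JordanCurve

variable {c : ℝ → ℂ}

/-- Otherwise the ray from w in direction ν would avoid the curve, forcing winding number 0. -/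
theorem re_conj_mul_sub_pos_of_mem_windingRegion (hc : IsC1JordanCurve c) {p ν : ℂ} (hν : ν ≠ 0)
    (h : ∀ t, 0 ≤ (conj ν * (p - c t)).re) {w : ℂ} (hw : w ∈ windingRegion c) :
    0 < (conj ν * (p - w)).re := by
  by_contra! hle
  refine one_ne_zero (α := ℂ) ?_
  rw [← hw.2]
  refine hc.windingNumber_eq_zero_of_ray hν fun s hs => ?_
  rcases hs.eq_or_lt with rfl | hs
  · simpa using hw.1
  · rintro ⟨t, ht⟩
    have h1 := h t
    have h2 : conj ν * (p - c t) = conj ν * (p - w) - ((s * Complex.normSq ν : ℝ) : ℂ) := by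
      rw [ht, Complex.ofReal_mul, Complex.normSq_eq_conj_mul_self]
      ring
    rw [h2, Complex.sub_re, Complex.ofReal_re] at h1
    have := mul_pos hs (Complex.normSq_pos.2 hν)
    linarith

theorem re_mul_cauchyTransform_pos (hc : IsC1JordanCurve c) (hne : (windingRegion c).Nonempty)
    {p ν : ℂ} (hν : ν ≠ 0) (h : ∀ t, 0 ≤ (conj ν * (p - c t)).re) :
    0 < (ν * ∫ w in windingRegion c, 1 / (p - w)).re :=
  re_mul_setIntegral_one_div_sub_pos hc.isBounded_windingRegion
    hc.isOpen_windingRegion.measurableSet (hc.isOpen_windingRegion.measure_ne_zero _ hne)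
    fun _ hw _ => hc.re_conj_mul_sub_pos_of_mem_windingRegion hν h hw

/-- If the Cauchy transform of the region inside a `C¹` Jordan curve is, along the curve, given by
the linear expression with parameter `Q`, then `|Q| < 1`. -/
theorem abs_lt_one_of_cauchyTransform_eq (hc : IsC1JordanCurve c)
    (hne : (windingRegion c).Nonempty) {Q : ℝ} {z₀ : ℂ}
    (hF : ∀ t, ∫ w in windingRegion c, 1 / (c t - w) =
      Real.pi * (conj (c t - z₀) - Q * (c t - z₀))) : |Q| < 1 := by
  -- At a point of the curve extreme in direction ν, the line normal to ν supports the curve.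
  have hex : ∀ ν : ℂ, ν ≠ 0 → ∃ t, (∀ s, (conj ν * c s).re ≤ (conj ν * c t).re) ∧
      0 < (ν * (conj (c t - z₀) - Q * (c t - z₀))).re := by
    intro ν hν
    obtain ⟨_, ⟨t, rfl⟩, ht⟩ := hc.isCompact_range.exists_isMaxOn (Set.range_nonempty c)
      (f := fun w => (conj ν * w).re) (by fun_prop)
    have hmax : ∀ s, (conj ν * c s).re ≤ (conj ν * c t).re := fun s => ht ⟨s, rfl⟩
    refine ⟨t, hmax, ?_⟩
    have h1 := hc.re_mul_cauchyTransform_pos hne (p := c t) hν (fun s => by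
      rw [mul_sub, Complex.sub_re]
      linarith [hmax s])
    rw [hF t, mul_left_comm, Complex.re_ofReal_mul] at h1
    exact pos_of_mul_pos_right h1 Real.pi_pos.le
  rw [abs_lt]
  constructor
  -- The transform condition reads (1 + Q)·y > 0 at the top and (1 + Q)·y < 0 at the bottom, with y
  -- measured from z₀; the directions ±1 give the same for 1 − Q.
  · obtain ⟨t, ht, h1⟩ := hex Complex.I Complex.I_ne_zero
    obtain ⟨s, -, h2⟩ := hex (-Complex.I) (neg_ne_zero.2 Complex.I_ne_zero)
    have h3 := ht s
    simp at h1 h2 h3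
    by_contra! hQ
    nlinarith
  · obtain ⟨t, ht, h1⟩ := hex 1 one_ne_zero
    obtain ⟨s, -, h2⟩ := hex (-1) (by simp)
    have h3 := ht s
    simp at h1 h2 h3
    by_contra! hQ
    nlinarith

/-- A `C¹` Jordan curve is an ellipse if it is contained in an elliptic disc that it touches and
whose Cauchy transform agrees with that of the region inside the curve. -/
theorem range_eq_ellipse (hc : IsC1JordanCurve c)
    (h01 : ∀ w ∉ Set.range c, windingNumber c w = 0 ∨ windingNumber c w = 1)
    (hnear : ∀ t, ∀ ε > 0, ∃ w ∉ Set.range c, dist w (c t) < ε ∧ windingNumber c w = 0)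
    {z₀ : ℂ} {a b : ℝ} (ha : 0 < a) (hb : 0 < b) (hE : ∀ t, c t ∈ ellipticDisc z₀ a b)
    {p : ℂ} (hp : p ∈ ellipse z₀ a b)
    (hF : ∫ w in windingRegion c, 1 / (p - w) =
      Real.pi * (conj (p - z₀) - (a - b) / (a + b) * (p - z₀))) :
    Set.range c = ellipse z₀ a b := by
  set S := windingRegion c with hS
  set E := ellipticDisc z₀ a b with hEdef
  set q : ℂ → ℝ := fun w => (w - z₀).re ^ 2 / a ^ 2 + (w - z₀).im ^ 2 / b ^ 2 with hq
  have hqc : Continuous q := by fun_prop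
  have hmemE : ∀ w, w ∈ E ↔ q w ≤ 1 := fun w => Iff.rfl
  have hmeml : ∀ w, w ∈ ellipse z₀ a b ↔ q w = 1 := fun w => Iff.rfl
  have hqray : ∀ (r : ℝ) (w : ℂ), q (z₀ + r * (w - z₀)) = r ^ 2 * q w := by
    intro r w
    simp only [hq, add_sub_cancel_left, Complex.re_ofReal_mul, Complex.im_ofReal_mul]
    ring
  -- From a point outside E the ray pointing away from z₀ stays outside E, hence misses the curve.
  have hSE : S ⊆ E := by
    intro w hw
    by_contra hwE
    rw [hmemE, not_le] at hwE
    have hwz : w - z₀ ≠ 0 := by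
      intro h
      simp only [hq, h] at hwE
      norm_num at hwE
    refine one_ne_zero (α := ℂ) ?_
    rw [← hw.2]
    refine hc.windingNumber_eq_zero_of_ray hwz fun s hs => ?_
    rintro ⟨t, ht⟩
    have h1 := (hmemE _).1 (hE t)
    rw [ht, show w + s * (w - z₀) = z₀ + ((1 + s : ℝ) : ℂ) * (w - z₀) by push_cast; ring,
      hqray] at h1
    have h2 : q w ≤ (1 + s) ^ 2 * q w :=
      le_mul_of_one_le_left (by linarith) (one_le_pow₀ (by linarith))
    linarith
  have hEcl : IsClosed E := isClosed_le hqc continuous_const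
  have hEb : Bornology.IsBounded E := by
    rw [hEdef, ellipticDisc_eq_image ha hb]
    exact ((isCompact_closedBall (0 : ℂ) 1).image (by fun_prop)).isBounded
  have hpE : p ∈ E := (hmemE p).2 ((hmeml p).1 hp).le
  have hSm : MeasurableSet S := hc.isOpen_windingRegion.measurableSet
  have hnull : MeasureTheory.volume (E \ S) = 0 := by
    by_contra h0
    have hdiff : ∫ w in E \ S, 1 / (p - w) = 0 := by
      rw [MeasureTheory.setIntegral_sdiff hSm (integrableOn_one_div_sub hEb p) hSE,
        setIntegral_ellipticDisc ha hb hpE, hF, sub_self]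
    -- Here ν is half the gradient of q at p, the outer normal of E; strict convexity of q puts E
    -- minus p strictly on one side of the tangent.
    have hpos := re_mul_setIntegral_one_div_sub_pos (hEb.subset Set.sdiff_subset)
      (hEcl.measurableSet.diff hSm) h0 (p := p)
      (ν := ⟨(p - z₀).re / a ^ 2, (p - z₀).im / b ^ 2⟩) (by
        intro w hw hwp
        have h1 := (hmeml p).1 hp
        have h2 := (hmemE w).1 hw.1
        have h3 : 0 < (p - w).re ^ 2 / a ^ 2 + (p - w).im ^ 2 / b ^ 2 := by
          rcases eq_or_ne (p - w).re 0 with h | h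
          · have h' : (p - w).im ≠ 0 := fun h' =>
              hwp (_root_.sub_eq_zero.1 (Complex.ext h h')).symm
            positivity
          · positivity
        have h4 : (p - w).re ^ 2 / a ^ 2 + (p - w).im ^ 2 / b ^ 2 = q w - q p +
            2 * ((conj (⟨(p - z₀).re / a ^ 2, (p - z₀).im / b ^ 2⟩ : ℂ)) * (p - w)).re := by
          simp [hq]
          ring
        linarith)
    rw [hdiff] at hpos
    simp at hpos
  have hempty : ∀ O : Set ℂ, IsOpen O → (∀ w ∈ O, q w < 1 ∧ w ∉ S) → ¬ O.Nonempty := by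
    intro O hO hOs hne
    refine hO.measure_ne_zero MeasureTheory.volume hne (MeasureTheory.measure_mono_null ?_ hnull)
    exact fun w hw => ⟨(hmemE w).2 (hOs w hw).1.le, (hOs w hw).2⟩
  have hzeroS : ∀ w, windingNumber c w = 0 → w ∉ S := by
    intro w hw hwS
    have := hwS.2
    rw [hw] at this
    exact zero_ne_one this
  have hUo : IsOpen {w | q w < 1} := isOpen_lt hqc continuous_const
  have hno : ∀ w ∉ Set.range c, windingNumber c w = 0 → 1 ≤ q w := by
    intro w hw hw0
    by_contra! hlt
    obtain ⟨ε, hε, h⟩ := hc.exists_ball_windingNumber_eq hw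
    exact hempty (Metric.ball w ε ∩ {w | q w < 1}) (Metric.isOpen_ball.inter hUo)
      (fun x hx => ⟨hx.2, hzeroS x ((h x hx.1).2.trans hw0)⟩)
      ⟨w, Metric.mem_ball_self hε, hlt⟩
  have hray : ∀ x : ℂ, Filter.Tendsto (fun r : ℝ => z₀ + r * (x - z₀)) (nhds 1) (nhds x) := by
    intro x
    have h : Continuous fun r : ℝ => z₀ + r * (x - z₀) := by fun_prop
    have := h.tendsto 1
    simpa using this
  ext x
  rw [hmeml]
  constructor
  · rintro ⟨t, rfl⟩
    refine le_antisymm ((hmemE _).1 (hE t)) ?_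
    by_contra! hlt
    obtain ⟨ε, hε, h⟩ := Metric.isOpen_iff.1 hUo _ hlt
    obtain ⟨w, hw, hwd, hw0⟩ := hnear t ε hε
    exact absurd (hno w hw hw0) (not_le.2 (h hwd))
  · intro hx
    by_contra hxc
    obtain ⟨ε, hε, h⟩ := hc.exists_ball_windingNumber_eq hxc
    obtain ⟨δ, hδ, hδ'⟩ := Metric.eventually_nhds_iff.1
      ((hray x).eventually (Metric.ball_mem_nhds x hε))
    -- Sliding x along its ray from z₀: inwards gives a point of winding number 0 inside the
    -- ellipse, outwards a point of S outside E.
    rcases h01 x hxc with h0 | h1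
    · have hd : dist (1 - min (δ / 2) (1 / 2)) 1 < δ := by
        rw [Real.dist_eq, show 1 - min (δ / 2) (1 / 2) - 1 = -min (δ / 2) (1 / 2) by ring, abs_neg,
          abs_of_pos (by positivity)]
        exact (min_le_left _ _).trans_lt (by linarith)
      have hb' := h _ (hδ' hd)
      have h2 := hno _ hb'.1 (hb'.2.trans h0)
      rw [hqray, hx] at h2
      have h3 : 0 < min (δ / 2) (1 / 2) := by positivity
      have h4 : min (δ / 2) (1 / 2) ≤ 1 / 2 := min_le_right _ _
      nlinarith
    · have hd : dist (1 + δ / 2) 1 < δ := by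
        rw [Real.dist_eq, add_sub_cancel_left, abs_of_pos (by positivity)]
        linarith
      have hb' := h _ (hδ' hd)
      have h2 := (hmemE _).1 (hSE ⟨hb'.1, hb'.2.trans h1⟩)
      rw [hqray, hx] at h2
      nlinarith

end IsC1JordanCurve

/-! ### Proof of the theorem -/

theorem mainTheorem3 (c : ℝ → ℂ) (D : Set ℂ) (hc : IsC1JordanCurve c) (hD : Encloses c D)
    (hpos : PositivelyOriented c D) (Q : ℝ) (z₀ : ℂ)
    (hγ : ∀ z ∈ D, cauchyIntegralConj c z = (Q : ℂ) * (z - z₀) + conj z₀) :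
    (∃ a b : ℝ, 0 < a ∧ 0 < b ∧ Set.range c = ellipse z₀ a b ∧ Q = (a - b) / (a + b)) ∧
      |Q| < 1 := by
  have hDc : ∀ z ∈ D, z ∉ Set.range c := by
    intro z hz hzc
    rw [← hD.frontier_eq, hD.isOpen.frontier_eq] at hzc
    exact hzc.2 hz
  obtain ⟨z₁, hz₁⟩ := hD.isConnected.nonempty
  obtain ⟨h01, hnear⟩ := hc.windingNumber_eq_zero_or_one (hDc z₁ hz₁) (hpos z₁ hz₁)
  have hne : (windingRegion c).Nonempty := ⟨z₁, hDc z₁ hz₁, hpos z₁ hz₁⟩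
  have hFD : Set.EqOn (fun z => ∫ w in windingRegion c, 1 / (z - w))
      (fun z => Real.pi * (conj (z - z₀) - Q * (z - z₀))) D := by
    intro z hz
    have h1 := hc.cauchyIntegralConj_eq h01 (hDc z hz)
    rw [hγ z hz, hpos z hz] at h1
    have hpi : (Real.pi : ℂ) ≠ 0 := by exact_mod_cast Real.pi_ne_zero
    simp only [map_sub]
    field_simp at h1
    linear_combination h1
  have hF : ∀ t, ∫ w in windingRegion c, 1 / (c t - w) =
      Real.pi * (conj (c t - z₀) - Q * (c t - z₀)) := by
    intro t
    have hcl : c t ∈ closure D := frontier_subset_closure (hD.frontier_eq ▸ ⟨t, rfl⟩)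
    exact hFD.closure hc.continuous_cauchyTransform_windingRegion (by fun_prop) hcl
  have hQ := hc.abs_lt_one_of_cauchyTransform_eq hne hF
  refine ⟨?_, hQ⟩
  obtain ⟨hQ1, hQ2⟩ := abs_lt.1 hQ
  have ha : 0 < 1 + Q := by linarith
  have hb : 0 < 1 - Q := by linarith
  -- The ratio of semi-axes is dictated by Q = (a − b)/(a + b); the maximum of q on the curve is T²,
  -- where T scales the smallest ellipse of this shape around it.
  set q : ℂ → ℝ := fun w => (w - z₀).re ^ 2 / (1 + Q) ^ 2 + (w - z₀).im ^ 2 / (1 - Q) ^ 2 with hq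
  obtain ⟨_, ⟨t, rfl⟩, ht⟩ := hc.isCompact_range.exists_isMaxOn (Set.range_nonempty c)
    (f := q) (by fun_prop)
  have hmax : ∀ s, q (c s) ≤ q (c t) := fun s => ht ⟨s, rfl⟩
  -- If the maximum were 0, the curve would be constant, against its nonvanishing derivative.
  have hT : 0 < q (c t) := by
    by_contra! hle
    have hconst : c = fun _ => z₀ := by
      funext s
      have h1 : q (c s) ≤ 0 := (hmax s).trans hle
      by_contra hne
      have h2 : 0 < q (c s) := by
        simp only [hq]
        rcases eq_or_ne (c s - z₀).re 0 with h | h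
        · have h' : (c s - z₀).im ≠ 0 := fun h' => hne (sub_eq_zero.1 (Complex.ext h h'))
          positivity
        · positivity
      linarith
    refine hc.deriv_ne_zero 0 ?_
    rw [hconst]
    simp
  set T := √(q (c t)) with hTdef
  have hT0 : 0 < T := Real.sqrt_pos.2 hT
  have hT2 : T ^ 2 = q (c t) := Real.sq_sqrt hT.le
  have hscale : ∀ w : ℂ, (w - z₀).re ^ 2 / (T * (1 + Q)) ^ 2 +
      (w - z₀).im ^ 2 / (T * (1 - Q)) ^ 2 = q w / T ^ 2 := by
    intro w
    simp only [hq]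
    field_simp
  have hratio : Q = (T * (1 + Q) - T * (1 - Q)) / (T * (1 + Q) + T * (1 - Q)) := by
    field_simp
    ring
  refine ⟨T * (1 + Q), T * (1 - Q), by positivity, by positivity, ?_, hratio⟩
  refine hc.range_eq_ellipse h01 hnear (by positivity) (by positivity) (fun s => ?_)
    (p := c t) ?_ ?_
  · rw [ellipticDisc, Set.mem_ofPred_eq, hscale, div_le_one (by positivity), hT2]
    exact hmax s
  · rw [ellipse, Set.mem_ofPred_eq, hscale, hT2, div_self hT.ne']
  · rw [hF t]
    have : (Q : ℂ) = ((T * (1 + Q) : ℝ) - (T * (1 - Q) : ℝ)) /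
        ((T * (1 + Q) : ℝ) + (T * (1 - Q) : ℝ)) := by
      exact_mod_cast hratio
    rw [← this]
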